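/- Let $(P,\preceq)$ be a finite poset with $|P|\ge 2$ whose Hasse diagram is a connected graph. A subset $\tau\subseteq P$ is called convex if $i\prec j\prec k$ with $i,k\in\tau$ implies $j\in\tau$, and connected if the subgraph of the Hasse diagram of $P$ induced on $\tau$ is connected. A *tube* is a nonempty convex connected subset $\tau\subseteq P$; it is *proper* if $1<|\tau|<|P|$. A *tubing* is a collection $\mathbf T$ of tubes such that any two elements of $\mathbf T$ are either nested (one contains the other) or disjoint, and such that the directed graph $D_{\mathbf T}$ with vertex set $\mathbf T$ and edge set $$\{(\tau,\tau') : \tau\cap\tau'=\emptyset \text{ and } i\prec j \text{ for some } i\in\tau,\ j\in\tau'\}$$ has no directed cycles. A tubing is *proper* if all its elements are proper tubes. Let $\mathcal K(P)$ be the abstract simplicial complex whose vertices are the proper tubes of $P$ and whose simplices are the proper tubings of $P$. Theorem (Poset associahedron). There exists a simplicial convex polytope $\mathscr A(P)^\ast$ of dimension $|P|-2$ (that is, a polytope all of whose proper faces are simplices) whose boundary complex, i.e. the simplicial complex formed by its proper faces, is isomorphic as a simplicial complex to $\mathcal K(P)$. -/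

import Mathlib

namespace PosetAssociahedron

section Polytopes

variable {E : Type*} [NormedAddCommGroup E] [NormedSpace ℝ E]

/-- A (nonempty) convex polytope: the convex hull of a nonempty finite set of points. -/
def IsPolytope (Q : Set E) : Prop :=
  ∃ V : Finset E, V.Nonempty ∧ Q = convexHull ℝ (V : Set E)

/-- The dimension of a (nonempty) polytope: the dimension of its affine hull. -/
noncomputable def polytopeDim (Q : Set E) : ℕ :=
  Module.finrank ℝ (vectorSpan ℝ Q)

/-- A proper face of `Q`: either the empty set, or the set of points of `Q` at which some linear
functional attains its maximum over `Q`; the polytope `Q` itself is excluded. -/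
def IsProperFace (Q F : Set E) : Prop :=
  IsExposed ℝ Q F ∧ F ≠ Q

/-- A simplex: the convex hull of a finite affinely independent set (the empty set included). -/
def IsSimplex (F : Set E) : Prop :=
  ∃ s : Finset E, AffineIndependent ℝ ((↑) : s → E) ∧ F = convexHull ℝ (s : Set E)

/-- A simplicial polytope: a polytope all of whose proper faces are simplices. -/
structure IsSimplicialPolytope (Q : Set E) : Prop where
  isPolytope : IsPolytope Q
  isSimplex_of_isProperFace : ∀ F : Set E, IsProperFace Q F → IsSimplex F

/-- `s` is the (nonempty) vertex set of a proper face of `Q`. -/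
def IsBoundaryFace (Q : Set E) (s : Finset E) : Prop :=
  s.Nonempty ∧ (s : Set E) ⊆ Q.extremePoints ℝ ∧ IsProperFace Q (convexHull ℝ (s : Set E))

theorem mem_of_mem_convexHull {Q : Set E} {t u : Finset E} (ht : (t : Set E) ⊆ Q.extremePoints ℝ)
    (hF : IsProperFace Q (convexHull ℝ (u : Set E))) {v : E} (hv : v ∈ t)
    (hvu : v ∈ convexHull ℝ (u : Set E)) : v ∈ u := by
  have h1 : v ∈ (convexHull ℝ (u : Set E)).extremePoints ℝ :=
    inter_extremePoints_subset_extremePoints_of_subset hF.1.subset ⟨hvu, ht hv⟩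
  exact extremePoints_convexHull_subset h1

theorem IsBoundaryFace.affineIndependent {Q : Set E} (hQ : IsSimplicialPolytope Q) {s : Finset E}
    (hs : IsBoundaryFace Q s) : AffineIndependent ℝ ((↑) : s → E) := by
  obtain ⟨_, hext, hF⟩ := hs
  obtain ⟨t, ht, hst⟩ := hQ.isSimplex_of_isProperFace _ hF
  have hsub : (s : Set E) ⊆ t := by
    intro v hv
    have hv1 : v ∈ convexHull ℝ (s : Set E) := subset_convexHull ℝ _ hv
    rw [hst] at hF hv1
    exact mem_of_mem_convexHull hext hF hv hv1
  exact ht.mono hsub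

theorem IsBoundaryFace.inter_subset {Q : Set E} {s t : Finset E} (hs : IsBoundaryFace Q s)
    (ht : IsBoundaryFace Q t) :
    convexHull ℝ (s : Set E) ∩ convexHull ℝ (t : Set E) ⊆ convexHull ℝ (s ∩ t : Set E) := by
  classical
  rintro x ⟨hxs, hxt⟩
  obtain ⟨l, hl⟩ := ht.2.2.1 ⟨x, hxt⟩
  have hxt' := hxt
  rw [hl] at hxt'
  obtain ⟨w, hw0, hw1, hwx⟩ := Finset.mem_convexHull'.1 hxs
  have hsQ : ∀ y ∈ s, y ∈ Q := fun y hy => (hs.2.1 hy).1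
  have hlx : ∑ y ∈ s, w y * (l x - l y) = 0 := by
    have h1 : l x = ∑ y ∈ s, w y * l y := by
      conv_lhs => rw [← hwx]
      simp [map_sum]
    simp only [mul_sub, Finset.sum_sub_distrib, ← Finset.sum_mul, hw1, ← h1]
    ring
  have hz := (Finset.sum_eq_zero_iff_of_nonneg
    (fun y hy => mul_nonneg (hw0 y hy) (sub_nonneg.2 (hxt'.2 y (hsQ y hy))))).1 hlx
  have hmem : ∀ y ∈ s, w y ≠ 0 → y ∈ t := by
    intro y hy hwy
    have h2 : l x = l y := by
      rcases mul_eq_zero.1 (hz y hy) with h | h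
      · exact absurd h hwy
      · linarith
    have h3 : y ∈ convexHull ℝ (t : Set E) := by
      rw [hl]
      exact ⟨hsQ y hy, fun z hz => by rw [← h2]; exact hxt'.2 z hz⟩
    exact mem_of_mem_convexHull hs.2.1 ht.2.2 hy h3
  rw [← hwx, ← Finset.sum_filter_of_ne (p := fun y => y ∈ t)
    (fun y hy hne => hmem y hy fun h => hne (by simp [h]))]
  refine (convex_convexHull ℝ _).sum_mem (fun y hy => hw0 y (Finset.mem_filter.1 hy).1) ?_
    (fun y hy => subset_convexHull ℝ _ (by simpa using hy))
  rw [← hw1]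
  exact Finset.sum_filter_of_ne (fun y hy hne => hmem y hy hne)

theorem exists_affineMap_of_affineIndependent [FiniteDimensional ℝ E] {s t : Finset E} (hst : s ⊆ t)
    (ht : AffineIndependent ℝ ((↑) : t → E)) :
    ∃ g : E →ᵃ[ℝ] ℝ, (∀ y ∈ s, g y = 1) ∧ ∀ y ∈ t, y ∉ s → g y = 0 := by
  classical
  obtain ⟨u, htu, hu, hspan⟩ := exists_subset_affineIndependent_affineSpan_eq_top
    (k := ℝ) (s := (t : Set E)) ht
  let b : AffineBasis u ℝ E := ⟨(↑), hu, by simpa using hspan⟩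
  have hb : ∀ i : u, b i = (i : E) := fun _ => rfl
  let g : E →ᵃ[ℝ] ℝ := ∑ i ∈ s.attach, b.coord ⟨i, htu (hst i.2)⟩
  have hg : ∀ y, g y = ∑ i ∈ s.attach, b.coord ⟨i, htu (hst i.2)⟩ y := by
    intro y
    have : ∀ (r : Finset {x // x ∈ s}), (∑ i ∈ r, b.coord ⟨i, htu (hst i.2)⟩) y
        = ∑ i ∈ r, b.coord ⟨i, htu (hst i.2)⟩ y := by
      intro r
      induction r using Finset.induction_on with
      | empty => simp
      | insert a r ha ih => rw [Finset.sum_insert ha, Finset.sum_insert ha, ← ih]; rfl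
    exact this _
  have hval : ∀ y (hy : y ∈ t), ∀ i : {x // x ∈ s},
      b.coord ⟨i, htu (hst i.2)⟩ y = if (i : E) = y then 1 else 0 := by
    intro y hy i
    have := b.coord_apply ⟨i, htu (hst i.2)⟩ ⟨y, htu hy⟩
    rw [hb] at this
    simpa using this
  refine ⟨g, fun y hy => ?_, fun y hy hys => ?_⟩
  · rw [hg, Finset.sum_congr rfl fun i _ => hval y (hst hy) i, Finset.sum_attach s
      (fun i => if i = y then (1 : ℝ) else 0)]
    simp [hy]
  · rw [hg, Finset.sum_congr rfl fun i _ => hval y hy i, Finset.sum_attach s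
      (fun i => if i = y then (1 : ℝ) else 0)]
    simp [hys]

theorem IsBoundaryFace.mono [FiniteDimensional ℝ E] {Q : Set E} (hQ : IsSimplicialPolytope Q)
    {s t : Finset E} (ht : IsBoundaryFace Q t) (hst : s ⊆ t) (hs : s.Nonempty) :
    IsBoundaryFace Q s := by
  classical
  have hind := ht.affineIndependent hQ
  obtain ⟨-, hext, hexp, hne⟩ := ht
  have hsub : convexHull ℝ (s : Set E) ⊆ convexHull ℝ (t : Set E) :=
    convexHull_mono (by exact_mod_cast hst)
  refine ⟨hs, fun y hy => hext (hst hy), fun _ => ?_, fun h => hne ?_⟩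
  swap
  · exact hexp.subset.antisymm (h ▸ hsub)
  obtain ⟨p, hp⟩ := hs
  have hpt : p ∈ convexHull ℝ (t : Set E) := subset_convexHull ℝ _ (hst hp)
  obtain ⟨l, hl⟩ := hexp ⟨p, hpt⟩
  have hpl := hpt
  rw [hl] at hpl
  obtain ⟨g, hg1, hg0⟩ := exists_affineMap_of_affineIndependent hst hind
  have hgc : Continuous g.linear := g.linear.continuous_of_finiteDimensional
  let gl : StrongDual ℝ E := ⟨g.linear, hgc⟩
  have hgl : ∀ y, gl y = g y - g p + gl p := by
    intro y
    have : g.linear (y - p) = g y - g p := by simpa using g.linearMap_vsub y p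
    have h2 : gl y - gl p = g y - g p := by rw [← this]; simp [gl]
    linarith
  have hgp : g p = 1 := hg1 p hp
  -- on the face spanned by `t`, `g` is at most one, with equality only on the face of `s`
  have hface : ∀ x ∈ convexHull ℝ (t : Set E), g x ≤ 1 ∧
      (1 ≤ g x → x ∈ convexHull ℝ (s : Set E)) := by
    intro x hx
    obtain ⟨w, hw0, hw1, hwx⟩ := Finset.mem_convexHull'.1 hx
    have hgx : g x = ∑ y ∈ s, w y := by
      have h1 : gl x = ∑ y ∈ t, w y * gl y := by
        conv_lhs => rw [← hwx]
        simp [map_sum]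
      have h2 : ∑ y ∈ t, w y * gl y = ∑ y ∈ t, w y * g y + (gl p - g p) := by
        have : ∀ y ∈ t, w y * gl y = w y * g y + w y * (gl p - g p) := by
          intro y _
          rw [hgl y]; ring
        rw [Finset.sum_congr rfl this, Finset.sum_add_distrib, ← Finset.sum_mul, hw1, one_mul]
      have h3 : ∑ y ∈ t, w y * g y = ∑ y ∈ s, w y := by
        rw [← Finset.sum_subset hst (fun y hy hys => by rw [hg0 y hy hys, mul_zero])]
        exact Finset.sum_congr rfl fun y hy => by rw [hg1 y hy, mul_one]
      have := hgl x
      linarith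
    have hsum : ∑ y ∈ t \ s, w y + ∑ y ∈ s, w y = 1 := by
      rw [Finset.sum_sdiff hst, hw1]
    have hnn : 0 ≤ ∑ y ∈ t \ s, w y :=
      Finset.sum_nonneg fun y hy => hw0 y (Finset.mem_sdiff.1 hy).1
    refine ⟨by linarith, fun h1 => ?_⟩
    have h0 : ∑ y ∈ t \ s, w y = 0 := by linarith
    have hz := (Finset.sum_eq_zero_iff_of_nonneg
      (fun y hy => hw0 y (Finset.mem_sdiff.1 hy).1)).1 h0
    rw [← hwx, ← Finset.sum_subset hst (fun y hy hys => by
      rw [hz y (Finset.mem_sdiff.2 ⟨hy, hys⟩), zero_smul])]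
    exact (convex_convexHull ℝ _).sum_mem (fun y hy => hw0 y (hst hy)) (by linarith)
      (fun y hy => subset_convexHull ℝ _ hy)
  obtain ⟨V, -, hV⟩ := hQ.isPolytope
  have hVQ : ∀ v ∈ V, v ∈ Q := fun v hv => hV ▸ subset_convexHull ℝ _ hv
  -- a multiple of `l` that dominates `g` on all vertices
  have hN : ∃ N : ℝ, 0 ≤ N ∧ ∀ v ∈ V, N * l v + gl v ≤ N * l p + gl p := by
    have key : ∀ W : Finset E, W ⊆ V →
        ∃ N : ℝ, 0 ≤ N ∧ ∀ v ∈ W, N * l v + gl v ≤ N * l p + gl p := by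
      intro W
      induction W using Finset.induction_on with
      | empty => intro _; exact ⟨0, le_rfl, by simp⟩
      | insert a W ha ih =>
        intro hW
        obtain ⟨N, hN0, hN⟩ := ih ((Finset.subset_insert a W).trans hW)
        have haV : a ∈ V := hW (Finset.mem_insert_self a W)
        have hle : ∀ v ∈ V, l v ≤ l p := fun v hv => hpl.2 v (hVQ v hv)
        rcases (hle a haV).eq_or_lt with h | h
        · refine ⟨N, hN0, fun v hv => ?_⟩
          rcases Finset.mem_insert.1 hv with rfl | hv
          · have : v ∈ convexHull ℝ (t : Set E) := by
              rw [hl]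
              exact ⟨hVQ v haV, fun z hz => by rw [h]; exact hpl.2 z hz⟩
            have h1 := (hface v this).1
            have h2 := hgl v
            rw [h]; linarith
          · exact hN v hv
        · refine ⟨max N ((gl a - gl p) / (l p - l a)), le_max_of_le_left hN0, fun v hv => ?_⟩
          rcases Finset.mem_insert.1 hv with rfl | hv
          · have h1 := le_max_right N ((gl v - gl p) / (l p - l v))
            rw [div_le_iff₀ (by linarith)] at h1
            linarith
          · have h1 := hN v hv
            have h2 := mul_le_mul_of_nonneg_right
              (le_max_left N ((gl a - gl p) / (l p - l a)))
              (sub_nonneg.2 (hle v (hW (Finset.mem_insert_of_mem hv))))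
            linarith
    exact key V subset_rfl
  obtain ⟨N, hN0, hN⟩ := hN
  have hNQ : ∀ x ∈ Q, N * l x + gl x ≤ N * l p + gl p := by
    have hc : Convex ℝ {x : E | (N • l + gl) x ≤ N * l p + gl p} :=
      convex_halfSpace_le (N • l + gl).toLinearMap.isLinear _
    intro x hx
    rw [hV] at hx
    have := convexHull_min (t := {x : E | (N • l + gl) x ≤ N * l p + gl p})
      (fun v hv => by simpa using hN v hv) hc hx
    simpa using this
  refine ⟨(N + 1) • l + gl, Set.Subset.antisymm (fun x hx => ?_) ?_⟩
  · have hxt := hsub hx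
    have hxt' := hxt
    rw [hl] at hxt'
    have hgx : g x = 1 := by
      refine le_antisymm (hface x hxt).1 ?_
      have hc : Convex ℝ {x : E | gl p ≤ gl x} :=
        convex_halfSpace_ge gl.toLinearMap.isLinear _
      have := convexHull_min (t := {x : E | gl p ≤ gl x}) (fun v hv => by
        have h1 := hgl v
        rw [hg1 v hv, hgp] at h1
        show gl p ≤ gl v
        linarith) hc hx
      have h2 := hgl x
      have h3 : gl p ≤ gl x := this
      linarith
    refine ⟨hxt'.1, fun y hy => ?_⟩
    have h1 := hNQ y hy
    have h2 := hgl x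
    have h3 := hxt'.2 y hy
    have h4 : l x = l p := le_antisymm (hpl.2 x hxt'.1) (hxt'.2 p hpl.1)
    simp only [add_apply, smul_apply, smul_eq_mul]
    rw [h4] at h3 ⊢
    linarith
  · rintro x ⟨hxQ, hx⟩
    have h1 := hx p hpl.1
    simp only [add_apply, smul_apply, smul_eq_mul] at h1
    have h2 := hNQ x hxQ
    have h3 := hpl.2 x hxQ
    have h4 : l x = l p := by linarith
    have hxt : x ∈ convexHull ℝ (t : Set E) := by
      rw [hl]
      exact ⟨hxQ, fun z hz => by rw [h4]; exact hpl.2 z hz⟩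
    refine (hface x hxt).2 ?_
    have h5 := hgl x
    rw [h4] at h1
    linarith

/-- The boundary complex of a simplicial polytope: the geometric simplicial complex formed by its
nonempty proper faces, each recorded (as usual for simplicial complexes) by its vertex set. -/
def boundaryComplex [FiniteDimensional ℝ E] (Q : Set E) (hQ : IsSimplicialPolytope Q) :
    Geometry.SimplicialComplex ℝ E where
  faces := {s | IsBoundaryFace Q s}
  isRelLowerSet_faces := fun {_} ht => ⟨ht.1, fun _ hst hs => IsBoundaryFace.mono hQ ht hst hs⟩
  indep := fun hs => IsBoundaryFace.affineIndependent hQ hs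
  inter_subset_convexHull := fun hs ht => IsBoundaryFace.inter_subset hs ht

end Polytopes

section Complexes

/-- The vertices of a simplicial complex (on a type of potential vertices). -/
def vertices {α : Type*} (K : PreAbstractSimplicialComplex α) : Set α :=
  {v | {v} ∈ K.faces}

/-- An isomorphism of simplicial complexes: a bijection of the vertices under which a finite set of
vertices is a simplex if and only if its image is a simplex. -/
structure ComplexIso {α β : Type*} (K : PreAbstractSimplicialComplex α)
    (L : PreAbstractSimplicialComplex β) where
  toEquiv : vertices K ≃ vertices L
  mem_faces_iff : ∀ S : Finset (vertices K),
    S.map (Function.Embedding.subtype _) ∈ K.faces ↔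
      (S.map toEquiv.toEmbedding).map (Function.Embedding.subtype _) ∈ L.faces

end Complexes

section Tubings

variable {P : Type*} [PartialOrder P]

/-- A tube: a nonempty subset of `P` which is convex (for the order) and induces a connected
subgraph of the Hasse diagram of `P`. -/
structure IsTube (τ : Set P) : Prop where
  nonempty : τ.Nonempty
  convex : ∀ ⦃i j k : P⦄, i ∈ τ → k ∈ τ → i < j → j < k → j ∈ τ
  connected : ((SimpleGraph.hasse P).induce τ).Connected

/-- The directed graph `D_T` of a collection `T` of subsets of `P`: there is an edge from `τ` to
`τ'` when they are disjoint and some element of `τ` lies strictly below some element of `τ'`. -/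
def tubingDigraph (T : Set (Set P)) : Digraph T where
  Adj τ τ' := Disjoint (τ : Set P) (τ' : Set P) ∧ ∃ i ∈ (τ : Set P), ∃ j ∈ (τ' : Set P), i < j

/-- A directed graph is acyclic: no vertex can be reached from itself by a directed path of positive
length. -/
def IsAcyclicDigraph {V : Type*} (D : Digraph V) : Prop :=
  ∀ v : V, ¬ Relation.TransGen D.Adj v v

/-- A tubing: a collection of tubes, pairwise nested or disjoint, whose digraph is acyclic. -/
structure IsTubing (T : Set (Set P)) : Prop where
  isTube : ∀ τ ∈ T, IsTube τ
  nested_or_disjoint : ∀ τ ∈ T, ∀ τ' ∈ T, τ ⊆ τ' ∨ τ' ⊆ τ ∨ Disjoint τ τ'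
  acyclic : IsAcyclicDigraph (tubingDigraph T)

/-- A proper tube: a tube `τ` with `1 < |τ| < |P|`. -/
structure IsProperTube (τ : Set P) : Prop where
  isTube : IsTube τ
  one_lt : 1 < τ.ncard
  lt_card : τ.ncard < Nat.card P

theorem IsTubing.mono {S T : Set (Set P)} (hT : IsTubing T) (hST : S ⊆ T) : IsTubing S where
  isTube τ hτ := hT.isTube τ (hST hτ)
  nested_or_disjoint τ hτ τ' hτ' := hT.nested_or_disjoint τ (hST hτ) τ' (hST hτ')
  acyclic v hv := hT.acyclic ⟨v, hST v.2⟩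
    (hv.lift (p := (tubingDigraph T).Adj) (fun x : S => (⟨x, hST x.2⟩ : T)) (fun _ _ h => h))

theorem isTubing_singleton {τ : Set P} (hτ : IsTube τ) : IsTubing {τ} where
  isTube := by rintro _ rfl; exact hτ
  nested_or_disjoint := by rintro _ rfl _ rfl; exact Or.inl subset_rfl
  acyclic := by
    have hno : ∀ x y : ({τ} : Set (Set P)), ¬ (tubingDigraph {τ}).Adj x y := by
      rintro ⟨_, rfl⟩ ⟨_, rfl⟩ ⟨hd, -⟩
      exact hτ.nonempty.ne_empty (disjoint_self.1 hd)
    intro v hv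
    obtain ⟨w, hw, -⟩ := Relation.TransGen.head'_iff.1 hv
    exact hno _ _ hw

variable (P) in
/-- The abstract simplicial complex whose vertices are the proper tubes of `P` and whose simplices
are the (nonempty, finite) proper tubings of `P`. -/
def tubingComplex : AbstractSimplicialComplex {τ : Set P // IsProperTube τ} where
  faces := {T | T.Nonempty ∧ IsTubing (Subtype.val '' (T : Set {τ : Set P // IsProperTube τ}))}
  isRelLowerSet_faces := fun {_} hT => ⟨hT.1, fun _ hST hS =>
    ⟨hS, hT.2.mono (Set.image_mono (by exact_mod_cast hST))⟩⟩
  singleton_mem v := ⟨Finset.singleton_nonempty v, by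
    simpa using isTubing_singleton v.2.isTube⟩

end Tubings

end PosetAssociahedron

/-!
The polytope is the polar dual of a simple polytope realizing the poset associahedron. For a set
`σ` of elements of `P` let `ordSum σ x` be the sum of the differences `x j - x i` over all pairs
`i < j` in `σ`. Let `M` be a large number, and consider the polyhedron of all `x : P → ℝ` with
`ordSum τ x ≥ M ^ |τ|` for all proper tubes `τ` and `ordSum univ x = M ^ |P|`, modulo translation
by constants. The heart of the matter is that the sets of tubes that are tight at some point of this
polyhedron are exactly the proper tubings.

* Tight sets are tubings (`isTubing_of_tight`). Points of the polyhedron are strictly monotone, so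
  on a tight tube `τ` their values differ by at most about `M ^ |τ|`. If two tight tubes crossed, or
  if some tight tubes formed a directed cycle, then all values on the convex hull of the union of
  these tubes would differ only by a multiple of `M ^ k`, with `k` the size of the largest of them.
  But that hull is itself a tube, has more than `k` elements, and so has order sum at least
  `M ^ (k + 1)`.
* Every tubing is a tight set (`IsTubing.exists_tight_iff`). Acyclicity gives, for every member `τ`
  of the tubing (and for `τ = P`), a linear extension of the order between the maximal pieces of
  `τ`. A combination of these linear extensions, with coefficients that solve a triangular linear
  system and whose sizes are governed by the powers `M ^ |τ|`, is tight exactly at the members.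

The polyhedron is bounded (`exists_ordSum_neg`) and has an interior point (take the empty tubing).
What remains is general (`IsFacePattern`): the faces of the polar dual are spanned by the tight
sets, and since tight sets are closed under passing to subsets, these faces are simplices
(`IsFacePattern.affineIndependent`).
-/

namespace PosetAssociahedron

/-! ### Polytopes spanned by finitely many points and the origin -/

section DualPolytope

variable {E : Type*} [NormedAddCommGroup E] [NormedSpace ℝ E] {ι : Type*}

/-- Points `u i` of a space `E`, together with a family `K` of finite sets of indices, such that
the polytope spanned by the `u i` and the origin has the origin in its interior (`exists_pos`), and
such that `K` consists of the index sets of its proper faces: a functional `l` with `l ≤ 1` on all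
`u i` cuts out the face spanned by those `u i` where `l = 1`. The functionals with `l ≤ 1` on all
`u i` are the points of the polar polytope, and the equations `l (u i) = 1` are its tight
constraints. -/
structure IsFacePattern (u : ι → E) (K : Finset ι → Prop) : Prop where
  exists_pos : ∀ l : StrongDual ℝ E, l ≠ 0 → ∃ i, 0 < l (u i)
  iff_exists : ∀ S, K S ↔ ∃ l : StrongDual ℝ E, (∀ i, l (u i) ≤ 1) ∧ ∀ i, i ∈ S ↔ l (u i) = 1
  mono : ∀ S T, S ⊆ T → K T → K S
  singleton : ∀ i, K {i}

/-- The convex hull of the points `u i` and the origin. The origin is added so that the polytope is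
nonempty also when there are no points. -/
def hullWithZero (u : ι → E) : Set E :=
  convexHull ℝ (insert 0 (Set.range u))

theorem mem_convexHull_filter_of_eq {V : Finset E} {l : StrongDual ℝ E} {c : ℝ}
    (hV : ∀ y ∈ V, l y ≤ c) {x : E} (hx : x ∈ convexHull ℝ (V : Set E)) (hc : l x = c) :
    x ∈ convexHull ℝ {y | y ∈ V ∧ l y = c} := by
  classical
  obtain ⟨w, hw0, hw1, hwx⟩ := Finset.mem_convexHull'.1 hx
  have hsum : ∑ y ∈ V, w y * (c - l y) = 0 := by
    have h1 : l x = ∑ y ∈ V, w y * l y := by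
      conv_lhs => rw [← hwx]
      simp [map_sum]
    simp only [mul_sub, Finset.sum_sub_distrib, ← Finset.sum_mul, hw1, ← h1, hc]
    ring
  have hz := (Finset.sum_eq_zero_iff_of_nonneg
    (fun y hy => mul_nonneg (hw0 y hy) (sub_nonneg.2 (hV y hy)))).1 hsum
  have hmem : ∀ y ∈ V, w y ≠ 0 → l y = c := by
    intro y hy hwy
    rcases mul_eq_zero.1 (hz y hy) with h | h
    · exact absurd h hwy
    · linarith
  rw [← hwx, ← Finset.sum_filter_of_ne (p := fun y => l y = c)
    (fun y hy hne => hmem y hy fun h => hne (by simp [h]))]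
  refine (convex_convexHull ℝ _).sum_mem (fun y hy => hw0 y (Finset.mem_filter.1 hy).1) ?_
    (fun y hy => subset_convexHull ℝ _ (by simpa using hy))
  rw [← hw1]
  exact Finset.sum_filter_of_ne (fun y hy hne => hmem y hy hne)

theorem mem_hullWithZero (u : ι → E) (i : ι) : u i ∈ hullWithZero u :=
  subset_convexHull ℝ _ (Or.inr ⟨i, rfl⟩)

theorem zero_mem_hullWithZero (u : ι → E) : (0 : E) ∈ hullWithZero u :=
  subset_convexHull ℝ _ (Or.inl rfl)

theorem le_one_of_mem_hullWithZero {u : ι → E} {l : StrongDual ℝ E} (hl : ∀ i, l (u i) ≤ 1)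
    {x : E} (hx : x ∈ hullWithZero u) : l x ≤ 1 := by
  have hc : Convex ℝ {x : E | l x ≤ 1} := convex_halfSpace_le l.toLinearMap.isLinear _
  refine convexHull_min ?_ hc hx
  rintro _ (rfl | ⟨i, rfl⟩)
  · simp
  · exact hl i

theorem eq_one_of_mem_convexHull {u : ι → E} {l : StrongDual ℝ E} {S : Set ι}
    (hS : ∀ i ∈ S, l (u i) = 1) {x : E} (hx : x ∈ convexHull ℝ (u '' S)) : l x = 1 := by
  have hc : Convex ℝ {x : E | l x = 1} := convex_hyperplane l.toLinearMap.isLinear _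
  refine convexHull_min ?_ hc hx
  rintro _ ⟨i, hi, rfl⟩
  exact hS i hi

theorem toExposed_hullWithZero [Finite ι] {u : ι → E} {l : StrongDual ℝ E}
    (hl : ∀ i, l (u i) ≤ 1) {S : Finset ι} (hS : ∀ i, i ∈ S ↔ l (u i) = 1) (hne : S.Nonempty) :
    {x ∈ hullWithZero u | ∀ y ∈ hullWithZero u, l y ≤ l x} = convexHull ℝ (u '' S) := by
  classical
  have := Fintype.ofFinite ι
  ext x
  constructor
  · rintro ⟨hx, hmax⟩
    obtain ⟨i, hi⟩ := hne
    have h1 : l x = 1 := le_antisymm (le_one_of_mem_hullWithZero hl hx)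
      ((hS i).1 hi ▸ hmax _ (mem_hullWithZero u i))
    have hV : (insert 0 (Set.range u) : Set E) = (insert 0 (Finset.univ.image u) : Finset E) := by
      simp
    rw [hullWithZero, hV] at hx
    refine convexHull_mono ?_ (mem_convexHull_filter_of_eq (l := l) (c := 1) ?_ hx h1)
    · rintro y ⟨hy, hy1⟩
      simp only [Finset.mem_insert, Finset.mem_image, Finset.mem_univ, true_and] at hy
      rcases hy with rfl | ⟨j, rfl⟩
      · simp at hy1
      · exact ⟨j, (hS j).2 hy1, rfl⟩
    · intro y hy
      simp only [Finset.mem_insert, Finset.mem_image, Finset.mem_univ, true_and] at hy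
      rcases hy with rfl | ⟨j, rfl⟩
      · simp
      · exact hl j
  · intro hx
    have h1 := eq_one_of_mem_convexHull (fun i hi => (hS i).1 hi) hx
    refine ⟨convexHull_mono ?_ hx, fun y hy => h1 ▸ le_one_of_mem_hullWithZero hl hy⟩
    rintro _ ⟨i, -, rfl⟩
    exact Or.inr ⟨i, rfl⟩

namespace IsFacePattern

variable {u : ι → E} {K : Finset ι → Prop}

theorem isProperFace [Finite ι] (h : IsFacePattern u K) {S : Finset ι} (hS : K S)
    (hne : S.Nonempty) : IsProperFace (hullWithZero u) (convexHull ℝ (u '' S)) := by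
  obtain ⟨l, hl, hlS⟩ := (h.iff_exists S).1 hS
  refine ⟨fun _ => ⟨l, (toExposed_hullWithZero hl hlS hne).symm⟩, fun heq => ?_⟩
  have h0 := zero_mem_hullWithZero u
  rw [← heq] at h0
  have := eq_one_of_mem_convexHull (fun i hi => (hlS i).1 hi) h0
  simp at this

theorem exists_of_isProperFace [Finite ι] (h : IsFacePattern u K) {F : Set E}
    (hF : IsProperFace (hullWithZero u) F) (hne : F.Nonempty) :
    ∃ S : Finset ι, K S ∧ S.Nonempty ∧ F = convexHull ℝ (u '' S) ∧
      ∃ l : StrongDual ℝ E, (∀ x ∈ F, l x = 1) ∧ ∀ i, i ∈ S ↔ l (u i) = 1 := by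
  classical
  have := Fintype.ofFinite ι
  obtain ⟨l, hl⟩ := hF.1 hne
  have hl0 : l ≠ 0 := by
    rintro rfl
    exact hF.2 (by rw [hl]; simp)
  obtain ⟨i₀, hi₀⟩ := h.exists_pos l hl0
  obtain ⟨i, -, hi⟩ := Finset.exists_max_image Finset.univ (fun i => l (u i))
    ⟨i₀, Finset.mem_univ _⟩
  have hpos : 0 < l (u i) := hi₀.trans_le (hi i₀ (Finset.mem_univ _))
  -- rescaled so that its maximum over the points is one
  set l' : StrongDual ℝ E := (l (u i))⁻¹ • l with hl'
  have hle : ∀ j, l' (u j) ≤ 1 := fun j => by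
    have := hi j (Finset.mem_univ _)
    simp only [hl', smul_apply, smul_eq_mul]
    rw [inv_mul_le_iff₀ hpos]
    simpa using this
  let S : Finset ι := Finset.univ.filter fun j => l' (u j) = 1
  have hS : ∀ j, j ∈ S ↔ l' (u j) = 1 := fun j => by simp [S]
  have hSne : S.Nonempty := ⟨i, (hS i).2 (by simp [hl', hpos.ne'])⟩
  have hFS : F = convexHull ℝ (u '' S) := by
    rw [← toExposed_hullWithZero hle hS hSne, hl]
    ext x
    simp only [Set.mem_ofPred_eq, hl', smul_apply, smul_eq_mul,
      mul_le_mul_iff_right₀ (inv_pos.2 hpos)]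
  refine ⟨S, (h.iff_exists S).2 ⟨l', hle, hS⟩, hSne, hFS, l', fun x hx => ?_, hS⟩
  rw [hFS] at hx
  exact eq_one_of_mem_convexHull (fun i hi => (hS i).1 hi) hx

theorem injective (h : IsFacePattern u K) : Function.Injective u := by
  intro i j hij
  obtain ⟨l, -, hl⟩ := (h.iff_exists {i}).1 (h.singleton i)
  have h1 := (hl i).1 (Finset.mem_singleton_self i)
  rw [hij, ← hl j, Finset.mem_singleton] at h1
  exact h1.symm

/-- A relation among the vertices of a face is impossible because the face spanned by the points
with negative coefficients does not contain the points with positive coefficients. -/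
theorem affineIndependent (h : IsFacePattern u K) {S : Finset ι} (hS : K S) :
    AffineIndependent ℝ (fun i : S => u i) := by
  classical
  rw [affineIndependent_iff]
  intro s w hw hwu
  let N : Finset ι := (s.filter fun i => w i < 0).map (Function.Embedding.subtype _)
  have hNS : N ⊆ S := by
    intro i hi
    obtain ⟨j, -, rfl⟩ := Finset.mem_map.1 hi
    exact j.2
  have hN : ∀ i ∈ s, (i : ι) ∈ N ↔ w i < 0 := by
    intro i hi
    simp [N, hi]
  obtain ⟨l, hle, hl⟩ := (h.iff_exists N).1 (h.mono N S hNS hS)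
  have hsum : ∑ i ∈ s, w i * (1 - l (u i)) = 0 := by
    have h1 := congrArg l hwu
    simp only [map_sum, map_smul, smul_eq_mul, map_zero] at h1
    simp [mul_sub, hw, h1]
  have hnn : ∀ i ∈ s, 0 ≤ w i * (1 - l (u i)) := by
    intro i hi
    rcases lt_or_ge (w i) 0 with hlt | hge
    · rw [(hl i).1 ((hN i hi).2 hlt)]; simp
    · exact mul_nonneg hge (sub_nonneg.2 (hle i))
  have hz := (Finset.sum_eq_zero_iff_of_nonneg hnn).1 hsum
  have hnp : ∀ i ∈ s, w i ≤ 0 := by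
    intro i hi
    by_contra! hlt
    rcases mul_eq_zero.1 (hz i hi) with h0 | h0
    · exact hlt.ne' h0
    · exact hlt.not_gt ((hN i hi).1 ((hl i).2 (by linarith)))
  exact (Finset.sum_eq_zero_iff_of_nonpos hnp).1 hw

theorem isSimplicialPolytope [Finite ι] (h : IsFacePattern u K) :
    IsSimplicialPolytope (hullWithZero u) := by
  classical
  have := Fintype.ofFinite ι
  refine ⟨⟨insert 0 (Finset.univ.image u), Finset.insert_nonempty _ _, by simp [hullWithZero]⟩,
    fun F hF => ?_⟩
  rcases F.eq_empty_or_nonempty with rfl | hne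
  · refine ⟨∅, ?_, by simp⟩
    exact affineIndependent_of_subsingleton ℝ _
  · obtain ⟨S, hS, -, hFS, -⟩ := h.exists_of_isProperFace hF hne
    refine ⟨S.image u, ?_, by simpa using hFS⟩
    have h1 := (h.affineIndependent hS).range
    have h2 : Set.range (fun i : S => u i) = (S.image u : Finset E) := by
      ext x; simp
    rw [h2] at h1
    exact h1

theorem mem_extremePoints [Finite ι] (h : IsFacePattern u K) (i : ι) :
    u i ∈ (hullWithZero u).extremePoints ℝ := by
  have h1 := (h.isProperFace (h.singleton i) (Finset.singleton_nonempty i)).1.isExtreme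
  simpa [isExtreme_singleton] using h1

theorem isBoundaryFace_image [Finite ι] [DecidableEq E] (h : IsFacePattern u K) (S : Finset ι) :
    IsBoundaryFace (hullWithZero u) (S.image u) ↔ S.Nonempty ∧ K S := by
  constructor
  · rintro ⟨hne, -, hF⟩
    obtain ⟨S', hS', -, -, l, hl1, hl⟩ := h.exists_of_isProperFace hF (by simpa using hne)
    refine ⟨by simpa using hne, h.mono S S' (fun i hi => (hl i).2 (hl1 _ ?_)) hS'⟩
    exact subset_convexHull ℝ _ (by simpa using ⟨i, hi, rfl⟩)
  · rintro ⟨hne, hS⟩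
    refine ⟨by simpa using hne, ?_, by simpa using h.isProperFace hS hne⟩
    intro x hx
    obtain ⟨i, -, rfl⟩ := Finset.mem_image.1 hx
    exact h.mem_extremePoints i

theorem mem_range_of_isBoundaryFace [Finite ι] (h : IsFacePattern u K) {x : E}
    (hx : IsBoundaryFace (hullWithZero u) {x}) : x ∈ Set.range u := by
  obtain ⟨-, hext, hF⟩ := hx
  obtain ⟨S', -, -, -, l, hl1, -⟩ := h.exists_of_isProperFace hF (by simp)
  rcases extremePoints_convexHull_subset (hext (by simp : x ∈ (({x} : Finset E) : Set E)))
    with rfl | hx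
  · have := hl1 0 (by simp)
    simp at this
  · exact hx

theorem polytopeDim_hullWithZero [FiniteDimensional ℝ E] (h : IsFacePattern u K) :
    polytopeDim (hullWithZero u) = Module.finrank ℝ E := by
  have htop : vectorSpan ℝ (hullWithZero u) = ⊤ := by
    by_contra hne
    obtain ⟨f, hf0, hf⟩ := Submodule.exists_le_ker_of_lt_top _ (lt_top_iff_ne_top.2 hne)
    obtain ⟨i, hi⟩ := h.exists_pos f.toContinuousLinearMap (by simpa using hf0)
    have h1 : u i -ᵥ (0 : E) ∈ vectorSpan ℝ (hullWithZero u) :=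
      vsub_mem_vectorSpan ℝ (mem_hullWithZero u i) (zero_mem_hullWithZero u)
    have h2 := hf h1
    simp at h2 hi
    exact hi.ne' h2
  rw [polytopeDim, htop, finrank_top]

/-- The isomorphism sends the vertex `u i` of the polytope to the vertex `i` of `L`. -/
theorem nonempty_complexIso [Finite ι] [FiniteDimensional ℝ E] (h : IsFacePattern u K)
    (L : AbstractSimplicialComplex ι) (hL : ∀ S, S ∈ L.faces ↔ S.Nonempty ∧ K S) :
    Nonempty (ComplexIso
      (boundaryComplex (hullWithZero u) h.isSimplicialPolytope).toPreAbstractSimplicialComplex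
      L.toPreAbstractSimplicialComplex) := by
  classical
  set B := (boundaryComplex (hullWithZero u) h.isSimplicialPolytope).toPreAbstractSimplicialComplex
  have hB : ∀ s, s ∈ B.faces ↔ IsBoundaryFace (hullWithZero u) s := fun _ => Iff.rfl
  have hvert : ∀ i, u i ∈ vertices B := fun i => by
    have := (h.isBoundaryFace_image {i}).2 ⟨Finset.singleton_nonempty i, h.singleton i⟩
    simpa [vertices, hB] using this
  have hL1 : ∀ i, i ∈ vertices L.toPreAbstractSimplicialComplex := fun i =>
    (hL {i}).2 ⟨Finset.singleton_nonempty i, h.singleton i⟩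
  let e : vertices L.toPreAbstractSimplicialComplex ≃ vertices B :=
    Equiv.ofBijective (fun i => ⟨u i, hvert i⟩)
      ⟨fun i j hij => Subtype.ext (h.injective (congrArg Subtype.val hij)), fun x => by
        obtain ⟨i, hi⟩ := h.mem_range_of_isBoundaryFace ((hB _).1 x.2)
        exact ⟨⟨i, hL1 i⟩, Subtype.ext hi⟩⟩
  refine ⟨e.symm, fun S => ?_⟩
  set S' : Finset ι := (S.map e.symm.toEmbedding).map (Function.Embedding.subtype _) with hS'
  have hSS' : S.map (Function.Embedding.subtype _) = S'.image u := by
    ext x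
    simp only [hS', Finset.mem_map, Finset.mem_image]
    constructor
    · rintro ⟨y, hy, rfl⟩
      refine ⟨_, ⟨_, ⟨y, hy, rfl⟩, rfl⟩, ?_⟩
      exact congrArg Subtype.val (e.apply_symm_apply y)
    · rintro ⟨_, ⟨_, ⟨y, hy, rfl⟩, rfl⟩, rfl⟩
      exact ⟨y, hy, (congrArg Subtype.val (e.apply_symm_apply y)).symm⟩
  rw [hSS', hB, h.isBoundaryFace_image]
  exact (hL S').symm

end IsFacePattern

end DualPolytope

/-! ### Tubes and comparability -/

section Tubes

variable {P : Type*} [PartialOrder P]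

/-- Connectedness of a tube, in terms of comparability instead of covering relations. -/
theorem IsTube.imp_of_forall_lt {τ : Set P} (hτ : IsTube τ) {p : P → Prop}
    (hp : ∀ i ∈ τ, ∀ j ∈ τ, i < j → (p i ↔ p j)) {i j : P} (hi : i ∈ τ) (hj : j ∈ τ) (h : p i) :
    p j := by
  have h1 := hτ.connected.preconnected ⟨i, hi⟩ ⟨j, hj⟩
  rw [SimpleGraph.reachable_iff_reflTransGen] at h1
  have key : ∀ b : τ, Relation.ReflTransGen ((SimpleGraph.hasse P).induce τ).Adj ⟨i, hi⟩ b →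
      p b := by
    intro b hb
    induction hb with
    | refl => exact h
    | @tail b c _ hbc ih =>
      rw [SimpleGraph.comap_adj, SimpleGraph.hasse_adj] at hbc
      rcases hbc with hbc | hbc
      · exact (hp b b.2 c c.2 hbc.lt).1 ih
      · exact (hp c c.2 b b.2 hbc.lt).2 ih
  exact key _ h1

theorem IsTube.of_forall_lt [Finite P] {τ : Set P} (hne : τ.Nonempty)
    (hconv : ∀ ⦃i j k : P⦄, i ∈ τ → k ∈ τ → i < j → j < k → j ∈ τ)
    (hτ : ∀ p : P → Prop, (∀ i ∈ τ, ∀ j ∈ τ, i < j → (p i ↔ p j)) →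
      ∀ i ∈ τ, ∀ j ∈ τ, p i → p j) : IsTube τ := by
  classical
  have := Fintype.ofFinite P
  let _ : LocallyFiniteOrder P := Fintype.toLocallyFiniteOrder
  have hreach : ∀ i j : P, Relation.TransGen (· ⋖ ·) i j → ∀ (hi : i ∈ τ) (hj : j ∈ τ),
      ((SimpleGraph.hasse P).induce τ).Reachable ⟨i, hi⟩ ⟨j, hj⟩ := by
    intro i j hij
    induction hij using Relation.TransGen.head_induction_on with
    | single h =>
      intro hi hj
      exact SimpleGraph.Adj.reachable (by
        rw [SimpleGraph.comap_adj, SimpleGraph.hasse_adj]; exact Or.inl h)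
    | @head a c hac hcj ih =>
      intro ha hj
      have hc : c ∈ τ := hconv ha hj hac.lt (lt_iff_transGen_covBy.2 hcj)
      refine SimpleGraph.Reachable.trans (SimpleGraph.Adj.reachable ?_) (ih hc hj)
      rw [SimpleGraph.comap_adj, SimpleGraph.hasse_adj]; exact Or.inl hac
  refine ⟨hne, hconv, ?_⟩
  have : Nonempty τ := hne.to_subtype
  refine ⟨fun ⟨i, hi⟩ ⟨j, hj⟩ => ?_⟩
  obtain ⟨_, h⟩ := hτ (fun k => ∃ hk : k ∈ τ,
    ((SimpleGraph.hasse P).induce τ).Reachable ⟨i, hi⟩ ⟨k, hk⟩) (fun a ha b hb hab => by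
      have h1 := hreach a b (lt_iff_transGen_covBy.1 hab) ha hb
      exact ⟨fun ⟨_, h⟩ => ⟨hb, h.trans h1⟩, fun ⟨_, h⟩ => ⟨ha, h.trans h1.symm⟩⟩)
    i hi j hj ⟨hi, SimpleGraph.Reachable.refl _⟩
  exact h

theorem isTube_univ (hconn : (SimpleGraph.hasse P).Connected) : IsTube (Set.univ : Set P) where
  nonempty := by
    have := hconn.nonempty
    exact Set.univ_nonempty
  convex := fun _ _ _ _ _ _ _ => trivial
  connected := (SimpleGraph.induceUnivIso _).connected_iff.2 hconn

theorem isTube_pair [Finite P] {i j : P} (h : i ⋖ j) : IsTube ({i, j} : Set P) := by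
  refine IsTube.of_forall_lt ⟨i, by simp⟩ ?_ ?_
  · rintro a b c (rfl | rfl) (rfl | rfl) hab hbc
    · exact absurd (hab.trans hbc) (lt_irrefl _)
    · exact absurd hbc (h.2 hab)
    · exact absurd (hab.trans hbc) h.lt.not_gt
    · exact absurd (hab.trans hbc) (lt_irrefl _)
  · intro p hp a ha b hb hpa
    have hij := hp i (by simp) j (by simp) h.lt
    rcases ha with rfl | rfl <;> rcases hb with rfl | rfl <;> tauto

theorem IsTube.isProperTube_or_eq_univ [Finite P] {σ : Set P} (hσ : IsTube σ) (h1 : 1 < σ.ncard) :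
    IsProperTube σ ∨ σ = Set.univ := by
  by_cases h : σ = Set.univ
  · exact Or.inr h
  · refine Or.inl ⟨hσ, h1, ?_⟩
    rw [← Set.ncard_univ]
    exact Set.ncard_lt_ncard ((Set.subset_univ _).ssubset_of_ne h)

theorem IsProperTube.ne_univ {σ : Set P} (hσ : IsProperTube σ) : σ ≠ Set.univ := by
  rintro rfl
  have := hσ.lt_card
  rw [Set.ncard_univ] at this
  exact lt_irrefl _ this

/-- The smallest convex set containing `U`. -/
def ordHull (U : Set P) : Set P :=
  {j | ∃ i ∈ U, ∃ k ∈ U, i ≤ j ∧ j ≤ k}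

theorem subset_ordHull (U : Set P) : U ⊆ ordHull U :=
  fun i hi => ⟨i, hi, i, hi, le_rfl, le_rfl⟩

/-- The convex hull of the union of a strongly connected family of tubes is a tube. Here an edge
leads from `A` to `B` if some element of `A` is at most some element of `B` (so that tubes that meet
are joined both ways), and strong connectedness is expressed by saying that no proper nonempty
subfamily is closed under passing along edges. -/
theorem isTube_ordHull_sUnion [Finite P] {C : Set (Set P)} (hne : C.Nonempty)
    (hC : ∀ τ ∈ C, IsTube τ)
    (hstrong : ∀ D ⊆ C, D.Nonempty →
      (∀ A ∈ D, ∀ B ∈ C, (∃ i ∈ A, ∃ j ∈ B, i ≤ j) → B ∈ D) → D = C) :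
    IsTube (ordHull (⋃₀ C)) := by
  have hsub := subset_ordHull (⋃₀ C)
  obtain ⟨τ₀, hτ₀⟩ := hne
  obtain ⟨i₀, hi₀⟩ := (hC τ₀ hτ₀).nonempty
  refine IsTube.of_forall_lt ⟨i₀, hsub ⟨τ₀, hτ₀, hi₀⟩⟩ ?_ ?_
  · rintro a b c ⟨i, hi, -, -, hia, -⟩ ⟨-, -, k, hk, -, hck⟩ hab hbc
    exact ⟨i, hi, k, hk, hia.trans hab.le, hbc.le.trans hck⟩
  · intro p hp
    have hp' : ∀ i ∈ ordHull (⋃₀ C), ∀ j ∈ ordHull (⋃₀ C), i ≤ j → (p i ↔ p j) := by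
      intro i hi j hj hij
      rcases hij.eq_or_lt with rfl | h
      · rfl
      · exact hp i hi j hj h
    have hin : ∀ A ∈ C, ∀ i ∈ A, i ∈ ordHull (⋃₀ C) := fun A hA i hi => hsub ⟨A, hA, hi⟩
    have hconst : ∀ A ∈ C, ∀ i ∈ A, ∀ j ∈ A, p i → p j := fun A hA i hi j hj =>
      (hC A hA).imp_of_forall_lt (fun a ha b hb => hp a (hin A hA a ha) b (hin A hA b hb)) hi hj
    rintro a ha b hb hpa
    obtain ⟨i, ⟨A, hA, hiA⟩, -, -, hia, -⟩ := id ha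
    obtain ⟨j, ⟨B, hB, hjB⟩, -, -, hjb, -⟩ := id hb
    have hD : {A ∈ C | ∀ i ∈ A, p i} = C := by
      refine hstrong _ (Set.sep_subset _ _) ⟨A, hA, fun k hk => ?_⟩ ?_
      · exact hconst A hA i hiA k hk ((hp' i (hin A hA i hiA) a ha hia).2 hpa)
      · rintro A' ⟨hA', hpA'⟩ B' hB' ⟨i', hi', j', hj', hij'⟩
        exact ⟨hB', fun k hk => hconst B' hB' j' hj' k hk
          ((hp' i' (hin A' hA' i' hi') j' (hin B' hB' j' hj') hij').1 (hpA' i' hi'))⟩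
    rw [← hD] at hB
    exact (hp' j (hin B hB.1 j hjB) b hb hjb).1 (hB.2 j hjB)

end Tubes

/-! ### Order sums -/

section OrderSums

variable {P : Type*} [PartialOrder P] [Fintype P]

open Classical in
/-- The pairs `(i, j)` of elements of `σ` with `i < j`. -/
noncomputable def ltPairs (σ : Set P) : Finset (P × P) :=
  Finset.univ.filter fun q => q.1 ∈ σ ∧ q.2 ∈ σ ∧ q.1 < q.2

theorem mem_ltPairs {σ : Set P} {q : P × P} : q ∈ ltPairs σ ↔ q.1 ∈ σ ∧ q.2 ∈ σ ∧ q.1 < q.2 := by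
  simp [ltPairs]

theorem card_ltPairs_le (σ : Set P) : (ltPairs σ).card ≤ Fintype.card P ^ 2 :=
  (Finset.card_le_univ _).trans (by rw [Fintype.card_prod, sq])

/-- The sum of the differences `x j - x i` over all pairs `i < j` of elements of `σ`. -/
noncomputable def ordSum (σ : Set P) : (P → ℝ) →ₗ[ℝ] ℝ :=
  ∑ q ∈ ltPairs σ,
    ((LinearMap.proj q.2 : (P → ℝ) →ₗ[ℝ] ℝ) - LinearMap.proj q.1)

theorem ordSum_apply (σ : Set P) (x : P → ℝ) :
    ordSum σ x = ∑ q ∈ ltPairs σ, (x q.2 - x q.1) := by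
  simp [ordSum]

theorem ordSum_const (σ : Set P) (c : ℝ) : ordSum σ (fun _ => c) = 0 := by
  simp [ordSum_apply]

theorem ordSum_le {σ : Set P} {x : P → ℝ} {D : ℝ} (hD : 0 ≤ D)
    (h : ∀ i ∈ σ, ∀ j ∈ σ, i < j → x j - x i ≤ D) :
    ordSum σ x ≤ (Fintype.card P : ℝ) ^ 2 * D := by
  rw [ordSum_apply]
  calc _ ≤ ∑ q ∈ ltPairs σ, D := Finset.sum_le_sum fun q hq => by
        obtain ⟨h1, h2, h3⟩ := mem_ltPairs.1 hq
        exact h _ h1 _ h2 h3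
    _ = (ltPairs σ).card * D := by simp
    _ ≤ _ := by
        gcongr
        exact_mod_cast card_ltPairs_le σ

theorem abs_ordSum_le {σ : Set P} {x : P → ℝ} {D : ℝ} (hD : 0 ≤ D)
    (h : ∀ i ∈ σ, ∀ j ∈ σ, i < j → |x j - x i| ≤ D) :
    |ordSum σ x| ≤ (Fintype.card P : ℝ) ^ 2 * D := by
  rw [abs_le]
  constructor
  · have := ordSum_le (x := -x) hD fun i hi j hj hij => by
      have := (abs_le.1 (h i hi j hj hij)).1
      simp only [Pi.neg_apply]
      linarith
    rw [map_neg] at this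
    linarith
  · exact ordSum_le hD fun i hi j hj hij => (abs_le.1 (h i hi j hj hij)).2

theorem sub_le_ordSum {σ : Set P} {x : P → ℝ} (hx : ∀ i ∈ σ, ∀ j ∈ σ, i < j → x i ≤ x j) {i j : P}
    (hi : i ∈ σ) (hj : j ∈ σ) (hij : i < j) : x j - x i ≤ ordSum σ x := by
  rw [ordSum_apply]
  refine Finset.single_le_sum (f := fun q : P × P => x q.2 - x q.1) (fun q hq => ?_)
    (mem_ltPairs.2 ⟨hi, hj, hij⟩ : (i, j) ∈ ltPairs σ)
  obtain ⟨h1, h2, h3⟩ := mem_ltPairs.1 hq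
  exact sub_nonneg.2 (hx _ h1 _ h2 h3)

theorem ordSum_eq_zero {σ : Set P} {x : P → ℝ} (hx : ∀ i ∈ σ, ∀ j ∈ σ, x i = x j) :
    ordSum σ x = 0 := by
  rw [ordSum_apply]
  refine Finset.sum_eq_zero fun q hq => ?_
  obtain ⟨h1, h2, -⟩ := mem_ltPairs.1 hq
  rw [hx _ h1 _ h2, sub_self]

theorem ordSum_pair {i j : P} (h : i < j) (x : P → ℝ) : ordSum {i, j} x = x j - x i := by
  have : ltPairs ({i, j} : Set P) = {(i, j)} := by
    ext ⟨a, b⟩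
    simp only [mem_ltPairs, Set.mem_insert_iff, Set.mem_singleton_iff, Finset.mem_singleton,
      Prod.mk.injEq]
    constructor
    · rintro ⟨rfl | rfl, rfl | rfl, hab⟩
      · exact absurd hab (lt_irrefl _)
      · exact ⟨rfl, rfl⟩
      · exact absurd hab h.not_gt
      · exact absurd hab (lt_irrefl _)
    · rintro ⟨rfl, rfl⟩
      exact ⟨Or.inl rfl, Or.inr rfl, h⟩
  rw [ordSum_apply, this, Finset.sum_singleton]

theorem monotone_of_ordSum_nonneg {x : P → ℝ}
    (hx : ∀ σ : Set P, IsTube σ → 1 < σ.ncard → 0 ≤ ordSum σ x) : Monotone x := by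
  classical
  let _ : LocallyFiniteOrder P := Fintype.toLocallyFiniteOrder
  rw [monotone_iff_forall_covBy]
  intro i j hij
  have := hx _ (isTube_pair hij) (by rw [Set.ncard_pair hij.ne]; norm_num)
  rw [ordSum_pair hij.lt] at this
  linarith

theorem strictMono_of_ordSum_pos {x : P → ℝ}
    (hx : ∀ σ : Set P, IsTube σ → 1 < σ.ncard → 0 < ordSum σ x) : StrictMono x := by
  classical
  let _ : LocallyFiniteOrder P := Fintype.toLocallyFiniteOrder
  rw [strictMono_iff_forall_covBy]
  intro i j hij
  have := hx _ (isTube_pair hij) (by rw [Set.ncard_pair hij.ne]; norm_num)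
  rw [ordSum_pair hij.lt] at this
  linarith

end OrderSums

/-! ### Tight tubes form tubings -/

section TightTubes

/-- If the values of `x` on `U` above `m` have no gap longer than `D`, they are at most
`m + |U| D`. -/
theorem le_add_card_mul_of_no_gap {α : Type*} (U : Finset α) (x : α → ℝ) {D m : ℝ} (hD : 0 ≤ D)
    (hgap : ∀ t, m ≤ t → (∃ u ∈ U, t < x u) → ∃ u ∈ U, t < x u ∧ x u ≤ t + D) :
    ∀ u ∈ U, x u ≤ m + U.card * D := by
  classical
  have key : ∀ k : ℕ, k ≤ (U.filter fun u => x u ≤ m + k * D).card ∨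
      ∀ u ∈ U, x u ≤ m + k * D := by
    intro k
    induction k with
    | zero => simp
    | succ k ih =>
      have hk : (m + k * D) + D = m + (k + 1 : ℕ) * D := by push_cast; ring
      by_cases hall : ∀ u ∈ U, x u ≤ m + k * D
      · exact Or.inr fun u hu => by linarith [hall u hu]
      · left
        have h1 := ih.resolve_right hall
        push Not at hall
        have hkD : 0 ≤ k * D := by positivity
        obtain ⟨u, hu, hlt, hle⟩ := hgap _ (by linarith) hall
        refine (Nat.succ_le_succ h1).trans (Finset.card_lt_card ?_)
        refine Finset.ssubset_iff_subset_ne.2 ⟨fun v hv => ?_, fun heq => ?_⟩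
        · rw [Finset.mem_filter] at hv ⊢
          exact ⟨hv.1, by linarith [hv.2]⟩
        · have : u ∈ U.filter fun u => x u ≤ m + k * D := by
            rw [heq, Finset.mem_filter]
            exact ⟨hu, by linarith⟩
          exact absurd (Finset.mem_filter.1 this).2 (not_le.2 hlt)
  rcases key U.card with h | h
  · have := Finset.eq_of_subset_of_card_le (Finset.filter_subset _ U) h
    intro u hu
    rw [← this] at hu
    exact (Finset.mem_filter.1 hu).2
  · exact h

variable {P : Type*} [PartialOrder P] [Fintype P] {M : ℝ} {x : P → ℝ}

/-- Tight tubes have small diameter. For a strongly connected family of them this bounds the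
diameter of the whole union, which is then too small for the convex hull of the union to satisfy
its own inequality. -/
theorem exists_sUnion_subset_of_tight (hM : (Fintype.card P : ℝ) ^ 3 < M) (hM1 : 1 ≤ M)
    (hx : ∀ σ : Set P, IsTube σ → 1 < σ.ncard → M ^ σ.ncard ≤ ordSum σ x)
    {C : Set (Set P)} (hne : C.Nonempty) (hC : ∀ τ ∈ C, IsTube τ)
    (htight : ∀ τ ∈ C, ordSum τ x = M ^ τ.ncard)
    (hstrong : ∀ D ⊆ C, D.Nonempty →
      (∀ A ∈ D, ∀ B ∈ C, (∃ i ∈ A, ∃ j ∈ B, i ≤ j) → B ∈ D) → D = C) :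
    ∃ τ ∈ C, ⋃₀ C ⊆ τ := by
  classical
  by_contra! hun
  have hM0 : 0 < M := by linarith
  have hmono : StrictMono x := strictMono_of_ordSum_pos fun σ h1 h2 =>
    (pow_pos hM0 _).trans_le (hx σ h1 h2)
  obtain ⟨τ, hτ, hmax⟩ := C.toFinite.exists_maximalFor Set.ncard C hne
  replace hmax : ∀ σ ∈ C, σ.ncard ≤ τ.ncard := fun σ hσ => by
    rcases le_total σ.ncard τ.ncard with h | h
    · exact h
    · exact hmax hσ h
  set D := M ^ τ.ncard with hDdef
  have hD : 0 < D := pow_pos hM0 _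
  have hdiff : ∀ σ ∈ C, ∀ i ∈ σ, ∀ j ∈ σ, i < j → x j - x i ≤ D := by
    intro σ hσ i hi j hj hij
    refine (sub_le_ordSum (fun a _ b _ hab => (hmono hab).le) hi hj hij).trans ?_
    rw [htight σ hσ]
    exact pow_le_pow_right₀ hM1 (hmax σ hσ)
  set U : Finset P := Finset.univ.filter fun i => i ∈ ⋃₀ C with hU
  have hUmem : ∀ i, i ∈ U ↔ i ∈ ⋃₀ C := fun i => by simp [hU]
  obtain ⟨iτ, hiτ⟩ := (hC τ hτ).nonempty
  obtain ⟨i₀, hi₀, hmin⟩ := U.exists_min_image x ⟨iτ, (hUmem _).2 ⟨τ, hτ, hiτ⟩⟩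
  have hbound := le_add_card_mul_of_no_gap U x (m := x i₀) hD.le (by
    rintro t ht ⟨u, hu, htu⟩
    by_contra! hgap
    -- the tubes on the upper side of the gap form a closed subfamily
    obtain ⟨A, hA, huA⟩ := (hUmem u).1 hu
    have hside : ∀ B ∈ C, ∀ i ∈ B, ∀ j ∈ B, t < x i → t < x j := by
      intro B hB i hi j hj
      refine (hC B hB).imp_of_forall_lt (p := fun i => t < x i) (fun a ha b hb hab => ?_) hi hj
      refine ⟨fun h => h.trans (hmono hab), fun h => ?_⟩
      have h1 := hgap b ((hUmem b).2 ⟨B, hB, hb⟩) h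
      have h2 := hdiff B hB a ha b hb hab
      linarith
    have hD : {B ∈ C | ∀ i ∈ B, t < x i} = C := by
      refine hstrong _ (Set.sep_subset _ _) ⟨A, hA, fun j hj => hside A hA u huA j hj htu⟩ ?_
      rintro A' ⟨hA', hpA'⟩ B' hB' ⟨i', hi', j', hj', hij'⟩
      exact ⟨hB', fun k hk => hside B' hB' j' hj' k hk
        ((hpA' i' hi').trans_le (hmono.monotone hij'))⟩
    obtain ⟨B, hB, hi₀B⟩ := (hUmem i₀).1 hi₀
    rw [← hD] at hB
    exact (hB.2 i₀ hi₀B).not_ge ht)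
  have hcard : (U.card : ℝ) ≤ Fintype.card P := by exact_mod_cast Finset.card_le_univ U
  set ρ := ordHull (⋃₀ C) with hρ
  have hρtube : IsTube ρ := isTube_ordHull_sUnion hne hC hstrong
  have hlt : τ.ncard < ρ.ncard := by
    refine Set.ncard_lt_ncard ⟨fun i hi => subset_ordHull _ ⟨τ, hτ, hi⟩, fun h => ?_⟩
    exact hun τ hτ ((subset_ordHull _).trans h)
  have h1 : 0 < τ.ncard := (Set.ncard_pos).2 (hC τ hτ).nonempty
  have hlow := hx ρ hρtube (by omega)
  have hup : ordSum ρ x ≤ (Fintype.card P : ℝ) ^ 2 * (Fintype.card P * D) := by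
    refine ordSum_le (by positivity) ?_
    rintro i ⟨a, ha, -, -, hai, -⟩ j ⟨-, -, b, hb, -, hjb⟩ -
    have h2 := hmin a ((hUmem a).2 ha)
    have h3 := hbound b ((hUmem b).2 hb)
    have h4 := hmono.monotone hai
    have h5 := hmono.monotone hjb
    have h6 := mul_le_mul_of_nonneg_right hcard hD.le
    linarith
  have h2 : M * D ≤ M ^ ρ.ncard := by
    rw [hDdef, ← pow_succ']
    exact pow_le_pow_right₀ hM1 hlt
  have h3 := mul_lt_mul_of_pos_right hM hD
  have h4 : (Fintype.card P : ℝ) ^ 2 * (Fintype.card P * D) = (Fintype.card P : ℝ) ^ 3 * D := by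
    ring
  linarith

/-- At a point that satisfies all inequalities, tight tubes form a tubing: crossing tubes, and the
tubes of a strongly connected component of a cyclic digraph, would be strongly connected families
without a member that contains all others. -/
theorem isTubing_of_tight (hM : (Fintype.card P : ℝ) ^ 3 < M) (hM1 : 1 ≤ M)
    (hx : ∀ σ : Set P, IsTube σ → 1 < σ.ncard → M ^ σ.ncard ≤ ordSum σ x)
    {T : Set (Set P)} (hT : ∀ τ ∈ T, IsTube τ) (htight : ∀ τ ∈ T, ordSum τ x = M ^ τ.ncard) :
    IsTubing T := by
  refine ⟨hT, fun σ hσ τ hτ => ?_, fun v hv => ?_⟩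
  · by_contra! hcon
    obtain ⟨hστ, hτσ, hdis⟩ := hcon
    obtain ⟨i, hi, hi'⟩ := Set.not_disjoint_iff.1 hdis
    have hCT : ({σ, τ} : Set (Set P)) ⊆ T := by
      rintro _ (rfl | rfl) <;> assumption
    obtain ⟨ρ, hρ, hsub⟩ := exists_sUnion_subset_of_tight hM hM1 hx (C := {σ, τ}) ⟨σ, by simp⟩
      (fun ρ hρ => hT ρ (hCT hρ)) (fun ρ hρ => htight ρ (hCT hρ)) (by
        rintro D hD ⟨A, hA⟩ hcl
        refine hD.antisymm fun B hB => hcl A hA B hB ⟨i, ?_, i, ?_, le_rfl⟩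
        · rcases hD hA with rfl | rfl <;> assumption
        · rcases hB with rfl | rfl <;> assumption)
    rcases hρ with rfl | rfl
    · exact hτσ fun j hj => hsub ⟨τ, by simp, hj⟩
    · exact hστ fun j hj => hsub ⟨σ, by simp, hj⟩
  · -- the strongly connected component of `v`
    set r := (tubingDigraph T).Adj with hr
    let C : Set (Set P) := {A | ∃ hA : A ∈ T, Relation.ReflTransGen r v ⟨A, hA⟩ ∧
      Relation.ReflTransGen r ⟨A, hA⟩ v}
    obtain ⟨τ, ⟨hτT, hvτ, hτv⟩, hsub⟩ := exists_sUnion_subset_of_tight hM hM1 hx (C := C)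
      ⟨v, v.2, .refl, .refl⟩ (fun ρ hρ => hT ρ hρ.1) (fun ρ hρ => htight ρ hρ.1) (by
        rintro D hD ⟨A, hA⟩ hcl
        refine hD.antisymm ?_
        rintro B ⟨hBT, hvB, hBv⟩
        obtain ⟨hAT, hvA, hAv⟩ := hD hA
        have key : ∀ a : T, Relation.ReflTransGen r a ⟨B, hBT⟩ → (a : Set P) ∈ D → B ∈ D := by
          intro a ha
          induction ha using Relation.ReflTransGen.head_induction_on with
          | refl => exact id
          | @head a c hac hcB ih =>
            intro haD
            obtain ⟨haT, hva, -⟩ := hD haD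
            obtain ⟨-, i, hi, j, hj, hij⟩ := id hac
            exact ih (hcl a haD c ⟨c.2, hva.tail hac, hcB.trans hBv⟩ ⟨i, hi, j, hj, hij.le⟩)
        exact key ⟨A, hAT⟩ (hAv.trans hvB) hA)
    have hcyc : Relation.TransGen r ⟨τ, hτT⟩ ⟨τ, hτT⟩ :=
      Relation.TransGen.trans_right hτv (hv.trans_left hvτ)
    obtain ⟨c, hc, hcτ⟩ := Relation.TransGen.head'_iff.1 hcyc
    obtain ⟨hdis, -, -, j, hj, -⟩ := id hc
    have hcC : (c : Set P) ∈ C := ⟨c.2, hvτ.tail hc, hcτ.trans hτv⟩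
    exact Set.disjoint_left.1 hdis (hsub ⟨c, hcC, hj⟩) hj

end TightTubes

/-! ### Acyclicity for the blocks of a tubing -/

section Blocks

variable {P : Type*} [PartialOrder P]

/-- A block of a collection `T` of tubes: a member of `T` or a singleton. -/
def IsBlock (T : Set (Set P)) (b : Set P) : Prop :=
  b ∈ T ∨ ∃ i, b = {i}

/-- The edges of the digraph of a collection of tubes, as a relation between arbitrary sets. -/
def tubeRel (T : Set (Set P)) (A B : Set P) : Prop :=
  A ∈ T ∧ B ∈ T ∧ Disjoint A B ∧ ∃ i ∈ A, ∃ j ∈ B, i < j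

/-- The analogue of `tubeRel` for the blocks of `T`. -/
def blockRel (T : Set (Set P)) (A B : Set P) : Prop :=
  IsBlock T A ∧ IsBlock T B ∧ Disjoint A B ∧ ∃ i ∈ A, ∃ j ∈ B, i < j

variable {T : Set (Set P)}

theorem IsTubing.not_transGen_tubeRel (hT : IsTubing T) (A : Set P) :
    ¬ Relation.TransGen (tubeRel T) A A := by
  have key : ∀ B, Relation.TransGen (tubeRel T) A B → ∃ (hA : A ∈ T) (hB : B ∈ T),
      Relation.TransGen (tubingDigraph T).Adj ⟨A, hA⟩ ⟨B, hB⟩ := by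
    intro B h
    induction h with
    | single h => exact ⟨h.1, h.2.1, .single h.2.2⟩
    | tail _ h ih =>
      obtain ⟨hA, hB, h1⟩ := ih
      exact ⟨hA, h.2.1, h1.tail h.2.2⟩
  intro h
  obtain ⟨hA, _, h1⟩ := key A h
  exact hT.acyclic _ h1

/-- A path of blocks that starts at a tube shortcuts to a path of tubes: by convexity and
nestedness, singletons on the way can be skipped. -/
theorem IsTubing.transGen_tubeRel_of_blockRel (hT : IsTubing T) {A B : Set P} (hA : A ∈ T)
    (h : Relation.TransGen (blockRel T) A B) :
    Relation.TransGen (tubeRel T) A B ∨ ∃ k, B = {k} ∧ ∃ C ∈ T,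
      Relation.ReflTransGen (tubeRel T) A C ∧ k ∉ C ∧ ∃ i ∈ C, i < k := by
  have start : ∀ B B', B ∈ T → Relation.ReflTransGen (tubeRel T) A B → blockRel T B B' →
      Relation.TransGen (tubeRel T) A B' ∨ ∃ k, B' = {k} ∧ ∃ C ∈ T,
      Relation.ReflTransGen (tubeRel T) A C ∧ k ∉ C ∧ ∃ i ∈ C, i < k := by
    rintro B B' hB hAB ⟨-, hB' | ⟨k, rfl⟩, hdis, i, hi, j, hj, hij⟩
    · exact Or.inl (Relation.TransGen.tail' hAB ⟨hB, hB', hdis, i, hi, j, hj, hij⟩)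
    · refine Or.inr ⟨k, rfl, B, hB, hAB, Set.disjoint_singleton_right.1 hdis, i, hi, ?_⟩
      rwa [Set.mem_singleton_iff.1 hj] at hij
  induction h with
  | single h => exact start A _ hA .refl h
  | @tail B B' _ hBB' ih =>
    rcases ih with hAB | ⟨k, rfl, C, hC, hAC, hkC, i, hi, hik⟩
    · obtain ⟨C, -, hC⟩ := Relation.TransGen.tail'_iff.1 hAB
      exact start B B' hC.2.1 hAB.to_reflTransGen hBB'
    · obtain ⟨-, hB', hdis, k', hk', j, hj, hkj⟩ := hBB'
      obtain rfl := Set.mem_singleton_iff.1 hk'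
      have hjC : j ∉ C := fun hjC => hkC ((hT.isTube C hC).convex hi hjC hik hkj)
      rcases hB' with hB' | ⟨j', rfl⟩
      · rcases hT.nested_or_disjoint C hC B' hB' with hs | hs | hs
        · exact absurd ((hT.isTube B' hB').convex (hs hi) hj hik hkj)
            (Set.disjoint_singleton_left.1 hdis)
        · exact absurd (hs hj) hjC
        · exact Or.inl (Relation.TransGen.tail' hAC ⟨hC, hB', hs, i, hi, j, hj, hik.trans hkj⟩)
      · obtain rfl := Set.mem_singleton_iff.1 hj
        exact Or.inr ⟨j, rfl, C, hC, hAC, hjC, i, hi, hik.trans hkj⟩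

/-- Adding all singletons to a tubing creates no cycles. A cycle through a tube shortcuts to a cycle
of tubes, and a cycle of singletons would be a cycle in the order of `P`. -/
theorem IsTubing.not_transGen_blockRel (hT : IsTubing T) (hT1 : ∀ τ ∈ T, 1 < τ.ncard)
    (A : Set P) : ¬ Relation.TransGen (blockRel T) A A := by
  have hmem : ∀ A ∈ T, ¬ Relation.TransGen (blockRel T) A A := by
    intro A hA h
    rcases hT.transGen_tubeRel_of_blockRel hA h with h | ⟨k, rfl, -⟩
    · exact hT.not_transGen_tubeRel A h
    · have := hT1 _ hA
      simp at this
  intro h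
  obtain ⟨_, hA, -⟩ := Relation.TransGen.head'_iff.1 h
  rcases hA.1 with hA | ⟨k, rfl⟩
  · exact hmem A hA h
  · have key : ∀ B, Relation.TransGen (blockRel T) {k} B → (∃ j, B = {j} ∧ k < j) ∨
        ∃ C ∈ T, Relation.TransGen (blockRel T) {k} C ∧ Relation.ReflTransGen (blockRel T) C B := by
      have step : ∀ l B, k ≤ l → Relation.ReflTransGen (blockRel T) {k} {l} →
          blockRel T {l} B → (∃ j, B = {j} ∧ k < j) ∨ ∃ C ∈ T,
          Relation.TransGen (blockRel T) {k} C ∧ Relation.ReflTransGen (blockRel T) C B := by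
        intro l B hkl hl hB
        obtain ⟨-, hBT | ⟨j', rfl⟩, -, l', hl', j, hj, hij⟩ := id hB
        · exact Or.inr ⟨B, hBT, Relation.TransGen.tail' hl hB, .refl⟩
        · obtain rfl := Set.mem_singleton_iff.1 hl'
          obtain rfl := Set.mem_singleton_iff.1 hj
          exact Or.inl ⟨j, rfl, hkl.trans_lt hij⟩
      intro B hB
      induction hB with
      | single h => exact step k _ le_rfl .refl h
      | @tail B B' hkB hBB' ih =>
        rcases ih with ⟨j, rfl, hkj⟩ | ⟨C, hC, hkC, hCB⟩
        · exact step j B' hkj.le hkB.to_reflTransGen hBB'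
        · exact Or.inr ⟨C, hC, hkC, hCB.tail hBB'⟩
    rcases key _ h with ⟨j, hj, hkj⟩ | ⟨C, hC, hkC, hCk⟩
    · exact hkj.ne (Set.singleton_injective hj)
    · exact hmem C hC (hkC.trans_right hCk)

/-- A strictly increasing rank on the acyclic digraph of blocks, namely the number of predecessors,
with a bound that depends on `P` only. -/
theorem IsTubing.exists_blockRank [Finite P] (hT : IsTubing T) (hT1 : ∀ τ ∈ T, 1 < τ.ncard) :
    ∃ g : Set P → ℕ, (∀ A B, blockRel T A B → g A < g B) ∧ ∀ A, g A ≤ 2 ^ Nat.card P := by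
  refine ⟨fun A => {B | Relation.TransGen (blockRel T) B A}.ncard, fun A B hAB => ?_, fun A => ?_⟩
  · refine Set.ncard_lt_ncard ⟨fun C hC => hC.tail hAB, fun h => ?_⟩
    exact hT.not_transGen_blockRel hT1 A (h (Relation.TransGen.single hAB))
  · refine (Set.ncard_le_ncard (Set.subset_univ _)).trans ?_
    have := Fintype.ofFinite P
    classical
    rw [Set.ncard_univ, Nat.card_eq_fintype_card, Nat.card_eq_fintype_card, Fintype.card_set]

theorem IsTubing.isBlock_nested (hT : IsTubing T) {b c : Set P} (hb : IsBlock T b)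
    (hc : IsBlock T c) {i : P} (hib : i ∈ b) (hic : i ∈ c) : b ⊆ c ∨ c ⊆ b := by
  rcases hb with hb | ⟨j, rfl⟩
  · rcases hc with hc | ⟨k, rfl⟩
    · rcases hT.nested_or_disjoint b hb c hc with h | h | h
      · exact Or.inl h
      · exact Or.inr h
      · exact absurd hic (Set.disjoint_left.1 h hib)
    · rw [Set.mem_singleton_iff] at hic
      exact Or.inr (by simpa [← hic] using hib)
  · rw [Set.mem_singleton_iff] at hib
    exact Or.inl (by simpa [← hib] using hic)

theorem IsTubing.exists_maximal_block [Finite P] (hT : IsTubing T) {τ : Set P}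
    (hτ : 1 < τ.ncard) {i : P} (hi : i ∈ τ) :
    ∃ b, IsBlock T b ∧ i ∈ b ∧ b ⊂ τ ∧ ∀ c, IsBlock T c → i ∈ c → c ⊂ τ → c ⊆ b := by
  have hi' : ({i} : Set P) ⊂ τ := by
    refine ⟨by simpa using hi, fun h => ?_⟩
    have := Set.ncard_le_ncard h
    rw [Set.ncard_singleton] at this
    omega
  obtain ⟨b, ⟨hb, hib, hbτ⟩, hmax⟩ := (Set.toFinite _).exists_maximalFor Set.ncard
    {b | IsBlock T b ∧ i ∈ b ∧ b ⊂ τ} ⟨{i}, Or.inr ⟨i, rfl⟩, rfl, hi'⟩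
  refine ⟨b, hb, hib, hbτ, fun c hc hic hcτ => ?_⟩
  rcases hT.isBlock_nested hb hc hib hic with h | h
  · exact (Set.eq_of_subset_of_ncard_le h (hmax ⟨hc, hic, hcτ⟩ (Set.ncard_le_ncard h))).ge
  · exact h

end Blocks

/-! ### Points realizing a tubing -/

section Realization

variable {P : Type*} [PartialOrder P] [Fintype P] {T : Set (Set P)}

/-- For a set `τ`, a function on `P` that vanishes outside `τ`, and that on `τ` is a linear
extension of the order between the maximal blocks strictly inside `τ`. Its order sum is positive on
every tube in `τ` that is not contained in a smaller member of `T`. -/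
theorem IsTubing.exists_levelFunction (hT : IsTubing T) (hT1 : ∀ τ ∈ T, 1 < τ.ncard)
    {τ : Set P} (hτ : 1 < τ.ncard) :
    ∃ f : P → ℝ, (∀ ρ ∈ T, ρ ⊂ τ → ∀ i ∈ ρ, ∀ j ∈ ρ, f i = f j) ∧ (∀ i, i ∉ τ → f i = 0) ∧
      (∀ i j, |f j - f i| ≤ 2 ^ Fintype.card P) ∧
      ∀ σ : Set P, IsTube σ → 1 < σ.ncard → σ ⊆ τ → (∀ ρ ∈ T, ρ ⊂ τ → ¬ σ ⊆ ρ) →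
        1 ≤ ordSum σ f := by
  classical
  obtain ⟨g, hg, hgle⟩ := hT.exists_blockRank hT1
  have hex := fun i (hi : i ∈ τ) => hT.exists_maximal_block hτ hi
  choose! b hb hib hbτ hmax using hex
  have hblock : ∀ i ∈ τ, ∀ j ∈ τ, j ∈ b i → b i = b j := by
    intro i hi j hj hji
    have h1 : b i ⊆ b j := hmax j hj _ (hb i hi) hji (hbτ i hi)
    exact h1.antisymm (hmax i hi _ (hb j hj) (h1 (hib i hi)) (hbτ j hj))
  let f : P → ℝ := fun i => if i ∈ τ then (g (b i) : ℝ) else 0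
  have hf : ∀ i ∈ τ, f i = g (b i) := fun i hi => by simp [f, hi]
  have hf0 : ∀ i, 0 ≤ f i ∧ f i ≤ 2 ^ Fintype.card P := by
    intro i
    simp only [f]
    split_ifs
    · refine ⟨by positivity, ?_⟩
      have := hgle (b i)
      rw [Nat.card_eq_fintype_card] at this
      exact_mod_cast this
    · exact ⟨le_rfl, by positivity⟩
  have hlt : ∀ i ∈ τ, ∀ j ∈ τ, i < j → b i = b j ∨ f i + 1 ≤ f j := by
    intro i hi j hj hij
    by_cases h : b i = b j
    · exact Or.inl h
    · right
      have hdis : Disjoint (b i) (b j) := by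
        rw [Set.disjoint_left]
        intro k hki hkj
        have hk := (hbτ i hi).1 hki
        exact h ((hblock i hi k hk hki).trans (hblock j hj k hk hkj).symm)
      have := hg (b i) (b j) ⟨hb i hi, hb j hj, hdis, i, hib i hi, j, hib j hj, hij⟩
      rw [hf i hi, hf j hj]
      exact_mod_cast this
  refine ⟨f, fun ρ hρ hρτ i hi j hj => ?_, fun i hi => by simp [f, hi], fun i j => ?_,
    fun σ hσ hσ1 hστ hσT => ?_⟩
  · have hji : j ∈ b i := hmax i (hρτ.1 hi) ρ (Or.inl hρ) hi hρτ hj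
    rw [hf i (hρτ.1 hi), hf j (hρτ.1 hj), hblock i (hρτ.1 hi) j (hρτ.1 hj) hji]
  · rw [abs_le]
    constructor <;> linarith [hf0 i, hf0 j]
  · have hle : ∀ i ∈ σ, ∀ j ∈ σ, i < j → f i ≤ f j := by
      intro i hi j hj hij
      rcases hlt i (hστ hi) j (hστ hj) hij with h | h
      · rw [hf i (hστ hi), hf j (hστ hj), h]
      · linarith
    by_contra! hcon
    have hb_eq : ∀ i ∈ σ, ∀ j ∈ σ, i < j → b i = b j := by
      intro i hi j hj hij
      refine (hlt i (hστ hi) j (hστ hj) hij).resolve_right fun h => ?_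
      linarith [sub_le_ordSum hle hi hj hij]
    obtain ⟨i, hi⟩ := hσ.nonempty
    have hσb : σ ⊆ b i := fun j hj => by
      have : b j = b i := hσ.imp_of_forall_lt (p := fun j => b j = b i)
        (fun a ha c hc hac => by rw [hb_eq a ha c hc hac]) hi hj rfl
      rw [← this]
      exact hib j (hστ hj)
    rcases hb i (hστ hi) with h | ⟨k, hk⟩
    · exact hσT _ h (hbτ i (hστ hi)) hσb
    · have := Set.ncard_le_ncard hσb
      rw [hk, Set.ncard_singleton] at this
      omega

open Classical in
/-- A linear system that is triangular with respect to strict inclusion has a solution. -/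
theorem exists_solution_triangular {α : Type*} [Finite α] (s : Finset (Set α)) (c : Set α → ℝ)
    (a : Set α → Set α → ℝ) (ha : ∀ τ ∈ s, a τ τ ≠ 0) :
    ∃ w : Set α → ℝ, ∀ τ ∈ s, w τ * a τ τ + ∑ ρ ∈ s with ρ ⊂ τ, w ρ * a τ ρ = c τ := by
  have hwf : WellFounded ((· < ·) : Set α → Set α → Prop) := wellFounded_lt
  let F : (τ : Set α) → ((ρ : Set α) → ρ < τ → ℝ) → ℝ := fun τ w =>
    (c τ - ∑ ρ ∈ (s.filter (· ⊂ τ)).attach, w ρ (Finset.mem_filter.1 ρ.2).2 * a τ ρ) / a τ τ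
  refine ⟨hwf.fix F, fun τ hτ => ?_⟩
  rw [hwf.fix_eq F τ]
  simp only [F]
  rw [Finset.sum_attach (s.filter (· ⊂ τ)) (fun ρ => hwf.fix F ρ * a τ ρ),
    div_mul_cancel₀ _ (ha τ hτ)]
  ring

/-- Every tubing is realized by a point: the tubes of the tubing are tight and all others are not.
The point is a combination of the functions of `IsTubing.exists_levelFunction`, whose coefficients
are of very different sizes, so that on each tube the smallest member of the tubing containing it
dominates. -/
theorem IsTubing.exists_tight_iff (hT : IsTubing T) (hT1 : ∀ τ ∈ T, 1 < τ.ncard)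
    (huniv : IsTube (Set.univ : Set P)) (hcard : 1 < Fintype.card P) {M : ℝ}
    (hM : 5 * 2 ^ Fintype.card P * ((Fintype.card P : ℝ) ^ 2 * 2 ^ Fintype.card P) ^ 2 ≤ M) :
    ∃ x : P → ℝ, (∀ τ ∈ insert Set.univ T, ordSum τ x = M ^ τ.ncard) ∧
      ∀ σ : Set P, IsTube σ → 1 < σ.ncard → σ ∉ insert Set.univ T →
        M ^ σ.ncard < ordSum σ x := by
  classical
  set s : Finset (Set P) := (insert Set.univ T : Set (Set P)).toFinset with hs
  have hmem : ∀ τ, τ ∈ s ↔ τ = Set.univ ∨ τ ∈ T := fun τ => by simp [hs]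
  have hs1 : ∀ τ ∈ s, 1 < τ.ncard := by
    intro τ hτ
    rcases (hmem τ).1 hτ with rfl | h
    · rwa [Set.ncard_univ, Nat.card_eq_fintype_card]
    · exact hT1 τ h
  have hstube : ∀ τ ∈ s, IsTube τ := by
    intro τ hτ
    rcases (hmem τ).1 hτ with rfl | h
    · exact huniv
    · exact hT.isTube τ h
  have hsT : ∀ ρ ∈ s, ∀ τ, ρ ⊂ τ → ρ ∈ T := by
    intro ρ hρ τ hρτ
    refine ((hmem ρ).1 hρ).resolve_left ?_
    rintro rfl
    exact hρτ.2 (Set.subset_univ _)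
  have hex := fun (τ : Set P) (hτ : 1 < τ.ncard) => hT.exists_levelFunction hT1 hτ
  choose! f hfconst hfzero hfabs hfpos using hex
  set A : ℝ := (Fintype.card P : ℝ) ^ 2 * 2 ^ Fintype.card P with hA
  set N : ℝ := 2 ^ Fintype.card P with hN
  have hN2 : 2 ≤ N := by
    calc (2 : ℝ) = 2 ^ 1 := by norm_num
      _ ≤ N := pow_le_pow_right₀ (by norm_num) hcard.le
  have hcard' : (1 : ℝ) ≤ Fintype.card P := by exact_mod_cast hcard.le
  have hA1 : 1 ≤ A := by
    have : 1 ≤ (Fintype.card P : ℝ) ^ 2 := one_le_pow₀ hcard'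
    nlinarith
  have hM1 : 1 ≤ M := by
    have : 1 ≤ A ^ 2 := one_le_pow₀ hA1
    nlinarith
  have hscard : (s.card : ℝ) ≤ N := by
    have := Finset.card_le_univ s
    rw [Fintype.card_set] at this
    rw [hN]
    exact_mod_cast this
  have habs : ∀ ρ ∈ s, ∀ σ, |ordSum σ (f ρ)| ≤ A := fun ρ hρ σ =>
    abs_ordSum_le (by positivity) fun i _ j _ _ => hfabs ρ (hs1 ρ hρ) i j
  have hdiag : ∀ τ ∈ s, 1 ≤ ordSum τ (f τ) := fun τ hτ =>
    hfpos τ (hs1 τ hτ) τ (hstube τ hτ) (hs1 τ hτ) subset_rfl fun ρ _ hρ => hρ.2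
  obtain ⟨w, hw⟩ := exists_solution_triangular s (fun τ => M ^ τ.ncard)
    (fun τ ρ => ordSum τ (f ρ)) fun τ hτ => (zero_lt_one.trans_le (hdiag τ hτ)).ne'
  -- the coefficients of smaller members contribute at most a multiple of the previous power of `M`
  have herr : ∀ τ, 1 < τ.ncard → (∀ ρ ∈ s, ρ ⊂ τ → |w ρ| ≤ 2 * M ^ ρ.ncard) → ∀ σ,
      |∑ ρ ∈ s with ρ ⊂ τ, w ρ * ordSum σ (f ρ)| ≤ 2 * N * A * M ^ (τ.ncard - 1) := by
    intro τ hτ1 hτ σ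
    calc _ ≤ ∑ ρ ∈ s with ρ ⊂ τ, |w ρ * ordSum σ (f ρ)| := Finset.abs_sum_le_sum_abs _ _
      _ ≤ ∑ ρ ∈ s with ρ ⊂ τ, (2 * M ^ (τ.ncard - 1)) * A := by
        refine Finset.sum_le_sum fun ρ hρ => ?_
        rw [Finset.mem_filter] at hρ
        rw [abs_mul]
        refine mul_le_mul ((hτ ρ hρ.1 hρ.2).trans ?_) (habs ρ hρ.1 σ) (abs_nonneg _) (by positivity)
        have := Set.ncard_lt_ncard hρ.2
        gcongr
        omega
      _ = (Finset.card (s.filter (· ⊂ τ)) : ℝ) * ((2 * M ^ (τ.ncard - 1)) * A) := by simp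
      _ ≤ N * ((2 * M ^ (τ.ncard - 1)) * A) := by
        have : (Finset.card (s.filter (· ⊂ τ)) : ℝ) ≤ s.card := by
          exact_mod_cast Finset.card_filter_le _ _
        have := this.trans hscard
        gcongr
      _ = _ := by ring
  -- the lower bound exceeds the error in `herr` by `N * A * M ^ (τ.ncard - 1)`, which is what makes
  -- the inequalities of the other tubes strict
  have hwbound : ∀ τ ∈ s, 3 * N * A * M ^ (τ.ncard - 1) ≤ w τ ∧ |w τ| ≤ 2 * M ^ τ.ncard := by
    intro τ
    induction τ using (wellFounded_lt (α := Set P)).induction with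
    | _ τ ih =>
      intro hτ
      have h1 := abs_le.1 (herr τ (hs1 τ hτ) (fun ρ hρ hρτ => (ih ρ hρτ hρ).2) τ)
      have h2 := hw τ hτ
      have h3 := hdiag τ hτ
      have h4 := (abs_le.1 (habs τ hτ τ)).2
      have hpow : M ^ τ.ncard = M * M ^ (τ.ncard - 1) := by
        rw [← pow_succ']
        congr 1
        have := hs1 τ hτ
        omega
      have hY : 0 < M ^ (τ.ncard - 1) := by positivity
      rw [hpow] at h2 ⊢
      generalize M ^ (τ.ncard - 1) = Y at *
      generalize (∑ ρ ∈ s with ρ ⊂ τ, w ρ * ordSum τ (f ρ)) = e at *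
      generalize ordSum τ (f τ) = a at *
      have hNA : 0 < N * A := by positivity
      have hNAA : N * A ≤ N * A ^ 2 := by
        have : A ≤ A ^ 2 := by nlinarith
        gcongr
      have hMY : 5 * N * A ^ 2 * Y ≤ M * Y := by gcongr
      have hNAY : N * A * Y ≤ N * A ^ 2 * Y := by gcongr
      have hNAY0 : 0 < N * A * Y := by positivity
      have hlow : 3 * N * A * Y ≤ w τ := by
        by_contra! hlt
        have h5 : w τ * a < 3 * N * A * Y * a := mul_lt_mul_of_pos_right hlt (by linarith)
        have h6 : 3 * N * A * Y * a ≤ 3 * N * A * Y * A := by gcongr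
        nlinarith
      refine ⟨hlow, ?_⟩
      have hw0 : 0 ≤ w τ := by linarith
      rw [abs_of_nonneg hw0]
      have : w τ ≤ w τ * a := le_mul_of_one_le_right hw0 h3
      linarith
  -- for `τ` the smallest member containing `σ`, only the terms of `τ` and its subsets contribute
  have hsum : ∀ τ ∈ s, ∀ σ ⊆ τ, ordSum σ (∑ ρ ∈ s, w ρ • f ρ) =
      w τ * ordSum σ (f τ) + ∑ ρ ∈ s with ρ ⊂ τ, w ρ * ordSum σ (f ρ) := by
    intro τ hτ σ hσ
    rw [map_sum, ← Finset.sum_insert (f := fun ρ => w ρ * ordSum σ (f ρ)) (by simp)]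
    simp only [map_smul, smul_eq_mul]
    refine (Finset.sum_subset (fun ρ hρ => ?_) fun ρ hρ hρ' => ?_).symm
    · rcases Finset.mem_insert.1 hρ with rfl | hρ
      · exact hτ
      · exact (Finset.mem_filter.1 hρ).1
    · rw [Finset.mem_insert, Finset.mem_filter] at hρ'
      push Not at hρ'
      obtain ⟨hne, hρτ⟩ := hρ'
      replace hρτ : ¬ ρ ⊆ τ := fun h => hρτ hρ (h.ssubset_of_ne hne)
      rw [mul_eq_zero]
      right
      have hcase : τ ⊂ ρ ∨ Disjoint τ ρ := by
        rcases (hmem ρ).1 hρ with rfl | hρT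
        · exact Or.inl ((Set.subset_univ _).ssubset_of_ne (Ne.symm hne))
        rcases (hmem τ).1 hτ with rfl | hτT
        · exact absurd (Set.subset_univ _) hρτ
        rcases hT.nested_or_disjoint τ hτT ρ hρT with h | h | h
        · exact Or.inl (h.ssubset_of_ne (Ne.symm hne))
        · exact absurd h hρτ
        · exact Or.inr h
      rcases hcase with h | h
      · exact ordSum_eq_zero fun i hi j hj =>
          hfconst ρ (hs1 ρ hρ) τ (hsT τ hτ ρ h) h i (hσ hi) j (hσ hj)
      · refine ordSum_eq_zero fun i hi j hj => ?_
        rw [hfzero ρ (hs1 ρ hρ) i (Set.disjoint_left.1 h (hσ hi)),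
          hfzero ρ (hs1 ρ hρ) j (Set.disjoint_left.1 h (hσ hj))]
  refine ⟨∑ ρ ∈ s, w ρ • f ρ, fun τ hτ => ?_, fun σ hσ hσ1 hσT => ?_⟩
  · have hτs : τ ∈ s := by simpa [hs] using hτ
    rw [hsum τ hτs τ subset_rfl, hw τ hτs]
  · have hσs : σ ∉ s := by simpa [hs] using hσT
    obtain ⟨τ, ⟨hτs, hστ⟩, hmin⟩ := (Set.toFinite {τ | τ ∈ s ∧ σ ⊆ τ}).exists_minimal
      ⟨Set.univ, (hmem _).2 (Or.inl rfl), Set.subset_univ _⟩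
    have hne : σ ≠ τ := by rintro rfl; exact hσs hτs
    have hlt := Set.ncard_lt_ncard (hστ.ssubset_of_ne hne)
    have h1 := hfpos τ (hs1 τ hτs) σ hσ hσ1 hστ fun ρ hρ hρτ hσρ =>
      hρτ.2 (hmin ⟨(hmem ρ).2 (Or.inr hρ), hσρ⟩ hρτ.1)
    have h2 := abs_le.1 (herr τ (hs1 τ hτs) (fun ρ hρ _ => (hwbound ρ hρ).2) σ)
    have h3 := (hwbound τ hτs).1
    have hY : 0 < M ^ (τ.ncard - 1) := by positivity
    have hσY : M ^ σ.ncard ≤ M ^ (τ.ncard - 1) := pow_le_pow_right₀ hM1 (by omega)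
    rw [hsum τ hτs σ hστ]
    generalize M ^ (τ.ncard - 1) = Y at *
    have hNA : 2 * Y ≤ N * A * Y := by
      have : 2 ≤ N * A := by nlinarith
      gcongr
    have hw0 : 0 ≤ w τ := by linarith
    have h4 : w τ ≤ w τ * ordSum σ (f τ) := le_mul_of_one_le_right hw0 h1
    linarith [h2.1]

end Realization

/-! ### The polar dual -/

section Polar

variable {P : Type*} [PartialOrder P] [Fintype P]

/-- The directions of the affine space `x p = 0`, `ordSum univ x = c`. Fixing the coordinate at `p`
removes the translations by constants, on which all order sums vanish. -/
noncomputable def directionSpace (p : P) : Submodule ℝ (P → ℝ) :=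
  LinearMap.ker ((LinearMap.proj p : (P → ℝ) →ₗ[ℝ] ℝ).prod (ordSum Set.univ))

theorem mem_directionSpace {p : P} {y : P → ℝ} :
    y ∈ directionSpace p ↔ y p = 0 ∧ ordSum Set.univ y = 0 := by
  simp [directionSpace]

theorem finrank_directionSpace (p : P) {z : P → ℝ} (hz : ordSum Set.univ z ≠ 0) :
    Module.finrank ℝ (directionSpace p) = Fintype.card P - 2 := by
  set F := (LinearMap.proj p : (P → ℝ) →ₗ[ℝ] ℝ).prod (ordSum Set.univ) with hF
  have hsurj : Function.Surjective F := by
    rintro ⟨a, b⟩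
    refine ⟨(fun _ => a - b / ordSum Set.univ z * z p) + (b / ordSum Set.univ z) • z, ?_⟩
    rw [hF, LinearMap.prod_apply]
    refine Prod.ext ?_ ?_
    · simp
    · simp [ordSum_const, div_mul_cancel₀ _ hz]
  have h := LinearMap.finrank_range_add_finrank_ker F
  rw [LinearMap.range_eq_top.2 hsurj, finrank_top, Module.finrank_prod, Module.finrank_self,
    Module.finrank_fintype_fun_eq_card] at h
  change Module.finrank ℝ (LinearMap.ker F) = _
  omega

/-- The realization space is bounded: a direction in which no order sum decreases is monotone, and
as its total order sum is zero it is constant. -/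
theorem exists_ordSum_neg (hconn : (SimpleGraph.hasse P).Connected) {p : P} {y : P → ℝ}
    (hy : y ∈ directionSpace p) (hy0 : y ≠ 0) :
    ∃ τ : Set P, IsProperTube τ ∧ ordSum τ y < 0 := by
  by_contra! hcon
  obtain ⟨hyp, hsum⟩ := mem_directionSpace.1 hy
  have hmono : Monotone y := monotone_of_ordSum_nonneg fun σ hσ h1 => by
    rcases hσ.isProperTube_or_eq_univ h1 with h | rfl
    · exact hcon σ h
    · exact hsum.ge
  refine hy0 (funext fun i => ?_)
  refine (isTube_univ hconn).imp_of_forall_lt (p := fun i => y i = 0) (fun a _ b _ hab => ?_)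
    (Set.mem_univ p) (Set.mem_univ i) hyp
  have h1 := sub_le_ordSum (σ := Set.univ) (fun i _ j _ hij => hmono hij.le)
    (Set.mem_univ a) (Set.mem_univ b) hab
  have h2 := hmono hab.le
  rw [hsum] at h1
  have h3 : y a = y b := by linarith
  rw [h3]

/-- The polar dual of the realization space: its points are the normalized inequalities of the
proper tubes, regarded as vectors through a linear isomorphism of `E` with the dual of the direction
space, and its faces correspond to the tubings. -/
theorem exists_isFacePattern (hconn : (SimpleGraph.hasse P).Connected)
    (hcard : 2 ≤ Fintype.card P) {E : Type*} [NormedAddCommGroup E] [NormedSpace ℝ E]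
    [FiniteDimensional ℝ E] (hE : Module.finrank ℝ E = Fintype.card P - 2) :
    ∃ u : {τ : Set P // IsProperTube τ} → E,
      IsFacePattern u fun S =>
        IsTubing (Subtype.val '' (S : Set {τ : Set P // IsProperTube τ})) := by
  classical
  set N : ℝ := 2 ^ Fintype.card P with hN
  set M : ℝ := 5 * N * ((Fintype.card P : ℝ) ^ 2 * N) ^ 2 with hMdef
  have hc2 : (2 : ℝ) ≤ Fintype.card P := by exact_mod_cast hcard
  have hN1 : 1 ≤ N := one_le_pow₀ (by norm_num)
  have hM3 : (Fintype.card P : ℝ) ^ 3 < M := by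
    have hN3 : 1 ≤ N ^ 3 := one_le_pow₀ hN1
    have hM' : M = 5 * Fintype.card P ^ 4 * N ^ 3 := by rw [hMdef]; ring
    have h3 : 0 < (Fintype.card P : ℝ) ^ 3 := by positivity
    have h4 : (Fintype.card P : ℝ) ^ 3 < 5 * Fintype.card P ^ 4 := by
      have : (Fintype.card P : ℝ) ^ 4 = Fintype.card P * Fintype.card P ^ 3 := by ring
      nlinarith
    rw [hM']
    exact h4.trans_le (le_mul_of_one_le_right (by positivity) hN3)
  have hM1 : 1 ≤ M := by
    have : 1 ≤ (Fintype.card P : ℝ) ^ 3 := one_le_pow₀ (by linarith)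
    linarith
  have huniv : IsTube (Set.univ : Set P) := isTube_univ hconn
  obtain ⟨p⟩ := hconn.nonempty
  have hempty : IsTubing (∅ : Set (Set P)) := (isTubing_singleton huniv).mono (Set.empty_subset _)
  -- an interior point of the realization space
  obtain ⟨o, ho, ho'⟩ := hempty.exists_tight_iff (by simp) huniv hcard le_rfl
  rw [← hMdef] at ho ho'
  have hM0 : 0 < M := by linarith
  have houniv : ordSum Set.univ o = M ^ (Set.univ : Set P).ncard := ho _ (by simp)
  have hopos : ∀ τ : {τ : Set P // IsProperTube τ}, 0 < ordSum τ.1 o - M ^ τ.1.ncard := fun τ =>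
    sub_pos.2 (ho' τ.1 τ.2.isTube τ.2.one_lt (by simpa using τ.2.ne_univ))
  have hrank : Module.finrank ℝ (directionSpace p) = Fintype.card P - 2 :=
    finrank_directionSpace p (z := o) (by rw [houniv]; positivity)
  let e : Module.Dual ℝ (directionSpace p) ≃ₗ[ℝ] E :=
    LinearEquiv.ofFinrankEq _ _ (by rw [Subspace.dual_finrank_eq, hrank, hE])
  -- the inequality of `τ` at `o + y`, normalized to the form `φ τ y ≤ 1`
  let φ : {τ : Set P // IsProperTube τ} → Module.Dual ℝ (directionSpace p) := fun τ =>
    (-(ordSum τ.1 o - M ^ τ.1.ncard)⁻¹) • (ordSum τ.1).comp (directionSpace p).subtype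
  have hφ : ∀ τ y, φ τ y = (ordSum τ.1 o - M ^ τ.1.ncard)⁻¹ * -ordSum τ.1 (y : P → ℝ) := by
    intro τ y
    simp [φ]
  have hφle : ∀ τ y, φ τ y ≤ 1 ↔ M ^ τ.1.ncard ≤ ordSum τ.1 (o + (y : P → ℝ)) := by
    intro τ y
    rw [hφ, inv_mul_le_iff₀ (hopos τ), map_add]
    constructor <;> intro h <;> linarith
  have hφeq : ∀ τ y, φ τ y = 1 ↔ ordSum τ.1 (o + (y : P → ℝ)) = M ^ τ.1.ncard := by
    intro τ y
    rw [hφ, inv_mul_eq_one₀ (hopos τ).ne', map_add]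
    constructor <;> intro h <;> linarith
  -- functionals on `E` are evaluations at directions
  have heval : ∀ l : StrongDual ℝ E, ∃ y : directionSpace p, ∀ ψ, l (e ψ) = ψ y := by
    intro l
    refine ⟨(Module.evalEquiv ℝ (directionSpace p)).symm (l.toLinearMap.comp e.toLinearMap),
      fun ψ => ?_⟩
    rw [Module.apply_evalEquiv_symm_apply]
    rfl
  refine ⟨fun τ => e (φ τ), fun l hl => ?_, fun S => ⟨fun hS => ?_, ?_⟩, fun S T hST hT => ?_,
    fun τ => ?_⟩
  · obtain ⟨y, hy⟩ := heval l
    have hy0 : (y : P → ℝ) ≠ 0 := by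
      intro h0
      obtain rfl : y = 0 := Subtype.ext h0
      refine hl (ContinuousLinearMap.ext fun v => ?_)
      have := hy (e.symm v)
      simpa using this
    obtain ⟨τ, hτ, hneg⟩ := exists_ordSum_neg hconn y.2 hy0
    refine ⟨⟨τ, hτ⟩, ?_⟩
    rw [hy, hφ]
    exact mul_pos (inv_pos.2 (hopos ⟨τ, hτ⟩)) (neg_pos.2 hneg)
  · obtain ⟨x, hx, hx'⟩ := hS.exists_tight_iff (by
      rintro _ ⟨τ, -, rfl⟩
      exact τ.2.one_lt) huniv hcard le_rfl
    rw [← hMdef] at hx hx'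
    -- the direction from `o` to `x`, shifted so as to vanish at `p`
    set c : P → ℝ := fun _ => x p - o p with hc
    have hmem : x - o - c ∈ directionSpace p := by
      rw [mem_directionSpace, map_sub, map_sub, ordSum_const, houniv, hx _ (by simp)]
      simp [hc]
    have hval : ∀ τ : {τ : Set P // IsProperTube τ},
        ordSum τ.1 (o + ((⟨_, hmem⟩ : directionSpace p) : P → ℝ)) = ordSum τ.1 x := by
      intro τ
      have : o + (x - o - c) = x - c := by abel
      rw [this, map_sub, hc, ordSum_const, sub_zero]
    let l : StrongDual ℝ E := LinearMap.toContinuousLinearMap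
      ((Module.Dual.eval ℝ (directionSpace p) ⟨_, hmem⟩).comp e.symm.toLinearMap)
    have hl : ∀ τ, l (e (φ τ)) = φ τ ⟨_, hmem⟩ := fun τ => by simp [l]
    have hnot : ∀ τ : {τ : Set P // IsProperTube τ}, τ ∉ S → M ^ τ.1.ncard < ordSum τ.1 x :=
      fun τ hτ => hx' τ.1 τ.2.isTube τ.2.one_lt (by
        rintro (h | ⟨σ, hσ, h⟩)
        · exact τ.2.ne_univ h
        · obtain rfl := Subtype.ext h
          exact hτ hσ)
    have hin : ∀ τ ∈ S, ordSum τ.1 x = M ^ τ.1.ncard := fun τ hτ =>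
      hx _ (Or.inr ⟨τ, hτ, rfl⟩)
    refine ⟨l, fun τ => ?_, fun τ => ?_⟩
    · rw [hl, hφle, hval]
      by_cases hτ : τ ∈ S
      · exact (hin τ hτ).ge
      · exact (hnot τ hτ).le
    · rw [hl, hφeq, hval]
      refine ⟨hin τ, fun h => ?_⟩
      by_contra hτ
      exact (hnot τ hτ).ne' h
  · rintro ⟨l, hl, hlS⟩
    obtain ⟨y, hy⟩ := heval l
    simp only [hy, hφle] at hl
    simp only [hy, hφeq] at hlS
    refine isTubing_of_tight hM3 hM1 (x := o + (y : P → ℝ)) (fun σ hσ h1 => ?_) ?_ ?_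
    · rcases hσ.isProperTube_or_eq_univ h1 with h | rfl
      · exact hl ⟨σ, h⟩
      · rw [map_add, (mem_directionSpace.1 y.2).2, add_zero, houniv]
    · rintro _ ⟨τ, -, rfl⟩
      exact τ.2.isTube
    · rintro _ ⟨τ, hτ, rfl⟩
      exact (hlS τ).1 hτ
  · exact hT.mono (Set.image_mono (by exact_mod_cast hST))
  · simpa using isTubing_singleton τ.2.isTube

end Polar

end PosetAssociahedron

theorem mainTheorem1 {P : Type*} [PartialOrder P] [Finite P]
    (hconn : (SimpleGraph.hasse P).Connected) (hcard : 2 ≤ Nat.card P) :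
    ∃ (Q : Set (EuclideanSpace ℝ (Fin (Nat.card P - 2))))
      (hQ : PosetAssociahedron.IsSimplicialPolytope Q),
      PosetAssociahedron.polytopeDim Q = Nat.card P - 2 ∧
      Nonempty (PosetAssociahedron.ComplexIso
        (PosetAssociahedron.boundaryComplex Q hQ).toPreAbstractSimplicialComplex
        (PosetAssociahedron.tubingComplex P).toPreAbstractSimplicialComplex) := by
  have := Fintype.ofFinite P
  obtain ⟨u, hu⟩ := PosetAssociahedron.exists_isFacePattern hconn
    (by rwa [← Nat.card_eq_fintype_card])
    (E := EuclideanSpace ℝ (Fin (Nat.card P - 2)))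
    (by rw [finrank_euclideanSpace_fin, Nat.card_eq_fintype_card])
  exact ⟨_, hu.isSimplicialPolytope,
    by rw [hu.polytopeDim_hullWithZero, finrank_euclideanSpace_fin],
    hu.nonempty_complexIso _ fun _ => Iff.rfl⟩
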